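/- Let $d\ge 1$, let $\mathcal N=\mathbb Z^d$ or $\mathcal N=\mathbb N^d$ (with $0\in\mathbb N$), put $|a|=\max(1,a_1^2+\dots+a_d^2)^{1/2}$ for $a\in\mathcal N$, and let $\mathcal Z=\mathcal N\times\{\pm1\}$, with $|j|=|a|$ and $\bar j=(a,-\delta)$ for $j=(a,\delta)$. For a sequence $z=(z_j)_{j\in\mathcal Z}$ of complex numbers write $\xi_a=z_{(a,1)}$, $\eta_a=z_{(a,-1)}$; $z$ is called real if $\eta_a=\overline{\xi_a}$ for all $a$. Let $\ell^1_s$ be the space of all $z$ with $\|z\|_{\ell^1_s}=\sum_{j}|j|^s|z_j|<\infty$, let $\ell^1=\ell^1_0$, and let $B^s_M=\{z:\|z\|_{\ell^1_s}\le M\}$. Let $r_0\ge 3$ and let $$P(z)=\sum_{\ell=2}^{r_0}\ \sum_{\boldsymbol j=(j_1,\dots,j_\ell)\in\mathcal Z^\ell} a_{\boldsymbol j}\,z_{j_1}\cdots z_{j_\ell}$$ where the coefficients are bounded, satisfy $a_{\bar{\boldsymbol j}}=\overline{a_{\boldsymbol j}}$, and have zero momentum: $a_{\boldsymbol j}=0$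 unless $\delta_1a_1+\dots+\delta_\ell a_\ell=0$, where $j_i=(a_i,\delta_i)$. Put $\|P\|=\sum_{\ell=2}^{r_0}\sup_{\boldsymbol j\in\mathcal Z^\ell}|a_{\boldsymbol j}|$. Let $\omega_a\in\mathbb R$ satisfy $|\omega_a|\le B|a|^m$ for all $a\in\mathcal N$, with constants $B,m>0$, and let $$H(z)=H_0(z)+P(z),\qquad H_0(z)=\sum_{a\in\mathcal N}\omega_a\xi_a\eta_a .$$ For a step size $h>0$ let $\alpha_h(x)=\sqrt h\,\arctan(x/\sqrt h)$ and $A_0(z)=\sum_{a}\alpha_h(h\omega_a)\xi_a\eta_a$. Let $\Phi_F^t$ denote the flow at time $t$ on $\ell^1$ of the Hamiltonian system $\dot\xi_a=-i\,\partial F/\partial\eta_a$, $\dot\eta_a=i\,\partial F/\partial\xi_a$; in particular $\Phi^1_{A_0}$ multiplies $\xi_a$ by $e^{-i\alpha_h(h\omega_a)}$ and $\eta_a$ by $e^{i\alpha_h(h\omega_a)}$. **Statement.** Let $M>0$ and $s\ge 3m/2$. There exist constants $h_0>0$ and $c>0$, depending only on $d$, $\mathcal N$, $r_0$, $s$, $M$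 and an upper bound for $\|P\|$, and a constant $C$, depending only on these and on $m$ and $B$, such that the following holds for every $0<h\le h_0$. If $(z^n)_{n\ge0}$ is a sequence such that $z^0$ is real, $z^{n+1}=\Phi_P^h\circ\Phi_{A_0}^1(z^n)$ for all $n\ge0$ (the flow of $P$ from $\Phi_{A_0}^1(z^n)$ being defined on $[0,h]$), and $z^n\in B^s_M$ for all $n\ge0$, then $$|H(z^n)-H(z^0)|\le C\,h\qquad\text{for all } n\ge0 \text{ with } nh\le\exp(c/\sqrt h).$$ -/

import Mathlib

open scoped ENNReal

noncomputable section

namespace Splitting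

/-- The index set `𝒵 = 𝒩 × {±1}`, for a set `𝒩` of modes in `ℤ^d`; the two signs are the
units of `ℤ`. -/
abbrev Idx {d : ℕ} (N : Set (Fin d → ℤ)) : Type := N × ℤˣ

variable {d : ℕ} {N : Set (Fin d → ℤ)}

/-- The size of a mode, `|a|² = max (1, a₁² + ⋯ + a_d²)`. -/
def modeSize (a : N) : ℝ := Real.sqrt (max 1 (∑ i, ((a : Fin d → ℤ) i : ℝ) ^ 2))

/-- The conjugate index `(a, -δ)` of `(a, δ)`. -/
def Idx.bar (j : Idx N) : Idx N := (j.1, -j.2)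

/-- A sequence `z = (ξ, η)`, with `ξ_a = z (a, 1)` and `η_a = z (a, -1)`, is real when `η` is the
complex conjugate of `ξ`. -/
def IsRealSeq (z : Idx N → ℂ) : Prop := ∀ j : Idx N, z j.bar = starRingEnd ℂ (z j)

/-- The closed ball of radius `M` centred at the origin of the weighted space `ℓ¹_s`, whose norm
is `∑_j |j|^s |z_j|`. -/
def ball (N : Set (Fin d → ℤ)) (s M : ℝ) : Set (Idx N → ℂ) :=
  {z | Summable (fun j : Idx N => modeSize j.1 ^ s * ‖z j‖) ∧
    ∑' j : Idx N, modeSize j.1 ^ s * ‖z j‖ ≤ M}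

/-- The momentum `δ₁ a₁ + ⋯ + δ_ℓ a_ℓ` of a multi-index. -/
def momentum {l : ℕ} (j : Fin l → Idx N) : Fin d → ℤ :=
  ∑ i, ((j i).2 : ℤ) • ((j i).1 : Fin d → ℤ)

/-- The class `𝒫_k` of polynomial Hamiltonians of degree at most `k` with a zero of order at least
two at the origin, given by their coefficients `a_j`: only monomials of zero momentum occur,
`a_{j̄}` is the complex conjugate of `a_j` (so that the Hamiltonian is real), and the coefficients
are bounded. -/
structure PolyHam (N : Set (Fin d → ℤ)) (k : ℕ) where
  coeff : (l : ℕ) → (Fin l → Idx N) → ℂ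
  coeff_eq_zero_of_degree : ∀ (l : ℕ) (j : Fin l → Idx N), l < 2 ∨ k < l → coeff l j = 0
  coeff_eq_zero_of_momentum : ∀ (l : ℕ) (j : Fin l → Idx N), momentum j ≠ 0 → coeff l j = 0
  coeff_bar : ∀ (l : ℕ) (j : Fin l → Idx N),
    coeff l (fun i => (j i).bar) = starRingEnd ℂ (coeff l j)
  bounded : ∃ C : ℝ, ∀ (l : ℕ) (j : Fin l → Idx N), ‖coeff l j‖ ≤ C

/-- The norm `‖P‖ = ∑_{ℓ=2}^k sup_j |a_j|`. -/
def PolyHam.norm {k : ℕ} (P : PolyHam N k) : ℝ :=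
  ∑ l ∈ Finset.Icc 2 k, ⨆ j : Fin l → Idx N, ‖P.coeff l j‖

/-- The value `P(z) = ∑_{ℓ=2}^k ∑_j a_j z_{j_1} ⋯ z_{j_ℓ}` (absolutely convergent on `ℓ¹`). -/
def PolyHam.eval {k : ℕ} (P : PolyHam N k) (z : Idx N → ℂ) : ℂ :=
  ∑ l ∈ Finset.Icc 2 k, ∑' j : Fin l → Idx N, P.coeff l j * ∏ i, z (j i)

/-- The Hamiltonian `H(z) = ∑_a ω_a ξ_a η_a + P(z)`. -/
def hamiltonian {k : ℕ} (ω : N → ℝ) (P : PolyHam N k) (z : Idx N → ℂ) : ℂ :=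
  ∑' a : N, (ω a : ℂ) * (z (a, 1) * z (a, -1)) + P.eval z

/-- The partial derivative `∂F/∂z_j`, the `z_j` being independent complex variables. -/
def partialDeriv (F : (Idx N → ℂ) → ℂ) (z : Idx N → ℂ) (j : Idx N) : ℂ :=
  deriv (fun w : ℂ => F (Function.update z j w)) (z j)

/-- The Hamiltonian vector field `X_F`: its `ξ_a`-component is `-i ∂F/∂η_a` and its
`η_a`-component is `i ∂F/∂ξ_a`. -/
def vectorField (F : (Idx N → ℂ) → ℂ) (z : Idx N → ℂ) (j : Idx N) : ℂ :=
  -Complex.I * ((j.2 : ℤ) : ℂ) * partialDeriv F z j.bar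

/-- `w = Φ_F^t(z)`: some solution of `φ' = X_F(φ)` in the Banach space `ℓ¹` on the time interval
`[0, t]` goes from `z` to `w`. -/
def IsFlow (F : (Idx N → ℂ) → ℂ) (t : ℝ) (z w : Idx N → ℂ) : Prop :=
  ∃ φ : ℝ → lp (fun _ : Idx N => ℂ) 1,
    (φ 0 : Idx N → ℂ) = z ∧ (φ t : Idx N → ℂ) = w ∧
    ∀ τ ∈ Set.Icc 0 t, ∃ v : lp (fun _ : Idx N => ℂ) 1,
      (v : Idx N → ℂ) = vectorField F (φ τ) ∧ HasDerivWithinAt φ v (Set.Icc 0 t) τ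

/-- The filter function `α_h(x) = √h arctan (x / √h)`. -/
def filterFun (h x : ℝ) : ℝ := Real.sqrt h * Real.arctan (x / Real.sqrt h)

/-- The time-one flow `Φ_{A₀}^1` of the quadratic Hamiltonian `A₀(z) = ∑_a α_h(h ω_a) ξ_a η_a`,
that is, of `ξ_a' = -i λ_a ξ_a`, `η_a' = i λ_a η_a` with `λ_a = α_h(h ω_a)`. -/
def filteredFlow (h : ℝ) (ω : N → ℝ) (z : Idx N → ℂ) (j : Idx N) : ℂ :=
  Complex.exp (-Complex.I * ((j.2 : ℤ) : ℂ) * (filterFun h (h * ω j.1) : ℂ)) * z j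

end Splitting

end

/-! The argument is backward error analysis. One step is the composition of the time-one flows of
`A₀` and of `hP`. By Baker–Campbell–Hausdorff it is formally the time-one flow of one Hamiltonian `Z
= A₀ + hP + ½{A₀, hP} + ⋯`, which it therefore preserves. The filter makes this usable: `arctan` is
bounded, so the vector field of `A₀` has size `O(√h)` on balls of `ℓ¹` whatever the frequencies are,
and that of `hP` has size `O(h)`. Zero momentum is what gives `P` a bounded field on `ℓ¹`.

Formal side. Truncated series with coefficients in a Lie algebra form a nilpotent Lie algebra, so
all exponentials are finite sums. `Z` is defined by `dexp Z (euler Z) = A + exp(ad A) P`, the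
logarithmic derivative, for the Euler derivation, of `exp(ad A) exp(ad P)`. A uniqueness argument
(`eq_of_euler_mul_eq`) gives `exp(ad Z) = exp(ad A) exp(ad P)`, and since `Z` commutes with itself,
`exp(ad A) exp(ad P) Z = Z`.

Analytic side. By Cauchy's estimate a Poisson bracket costs `2/δ` when the radius of the ball drops
by `δ`. Spreading a total loss `δ` over `n` degrees gives a norm on series whose bracket has
constant `2n/δ` (`isLieBound_gradedNorm`), so the term of degree `i + 1` in `Z` is of size `β (C i
√h)^i` with `β = O(h)`. Truncation at an order proportional to `1/√h` changes `Z` by an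
exponentially small amount in one step (`exists_almost_invariant`).

Comparison with `hH`. On the weighted ball, `A₀` differs from `hH₀` by `O(h²)`, because `arctan x -
x = O(x³)` and `3m ≤ 2s`. The bracket `{A₀, hP}` is also `O(h²)`, because there the field of `A₀` is
`O(h)` and not merely `O(√h)`. The later terms are `O(h · (√h)²)`. So the modified energy is `hH +
O(h²)` and drifts by `O(h²)` over exponentially long times; division by `h` gives the theorem. -/

set_option linter.unusedSectionVars false

/-! ### The nilpotent Lie algebra of truncated power series. -/

/-- Truncated formal power series without constant term with coefficients in `L`: the entry of
index `i` is the coefficient of degree `i + 1`. -/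
def TruncSeries (N : ℕ) (L : Type*) : Type _ := Fin N → L

namespace TruncSeries

variable {N : ℕ} {L : Type*} [LieRing L] [LieAlgebra ℂ L]

instance : AddCommGroup (TruncSeries N L) := inferInstanceAs (AddCommGroup (Fin N → L))

instance : Module ℂ (TruncSeries N L) := inferInstanceAs (Module ℂ (Fin N → L))

@[ext] theorem ext {f g : TruncSeries N L} (h : ∀ n, f n = g n) : f = g := funext h

@[simp] theorem add_apply (f g : TruncSeries N L) (n : Fin N) : (f + g) n = f n + g n := rfl
@[simp] theorem sub_apply (f g : TruncSeries N L) (n : Fin N) : (f - g) n = f n - g n := rfl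
@[simp] theorem zero_apply (n : Fin N) : (0 : TruncSeries N L) n = 0 := rfl
@[simp] theorem smul_apply (c : ℂ) (f : TruncSeries N L) (n : Fin N) : (c • f) n = c • f n := rfl

/-- Evaluation of a coefficient, as a linear map. -/
def coeffₗ (n : Fin N) : TruncSeries N L →ₗ[ℂ] L where
  toFun f := f n
  map_add' _ _ := rfl
  map_smul' _ _ := rfl

@[simp] theorem coeffₗ_apply (n : Fin N) (f : TruncSeries N L) : coeffₗ n f = f n := rfl

theorem sum_apply {ι : Type*} (s : Finset ι) (f : ι → TruncSeries N L) (n : Fin N) :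
    (∑ i ∈ s, f i) n = ∑ i ∈ s, f i n :=
  map_sum (coeffₗ n) f s

instance : Bracket (TruncSeries N L) (TruncSeries N L) where
  bracket f g := fun n : Fin N =>
    ∑ i : Fin N, ∑ j : Fin N, if (i : ℕ) + j + 1 = n then ⁅f i, g j⁆ else 0

theorem lie_apply (f g : TruncSeries N L) (n : Fin N) :
    ⁅f, g⁆ n = ∑ i : Fin N, ∑ j : Fin N, if (i : ℕ) + j + 1 = n then ⁅f i, g j⁆ else 0 := rfl

/-- The intermediate degree in a double bracket is determined by the other degrees. Truncation does
no harm: if `b + c + 1` exceeds the range, then so does `a + b + c + 2`, which cannot equal `n`. -/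
theorem sum_ite_shift (a b c n : Fin N) (x : L) :
    (∑ m : Fin N, if (a : ℕ) + m + 1 = n then (if (b : ℕ) + c + 1 = m then x else 0) else 0)
      = if (a : ℕ) + b + c + 2 = n then x else 0 := by
  by_cases h : (a : ℕ) + b + c + 2 = n
  · have hm : (b : ℕ) + c + 1 < N := by have := n.2; omega
    rw [Finset.sum_eq_single (⟨(b : ℕ) + c + 1, hm⟩ : Fin N)]
    · simp only [if_true]
      rw [if_pos (by omega), if_pos h]
    · intro m _ hne
      split_ifs with h1 h2
      · exact absurd (Fin.ext h2.symm) hne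
      · rfl
      · rfl
    · simp
  · rw [if_neg h]
    refine Finset.sum_eq_zero fun m _ => ?_
    split_ifs with h1 h2
    · omega
    · rfl
    · rfl

theorem lie_lie_apply (f g h : TruncSeries N L) (n : Fin N) :
    ⁅f, ⁅g, h⁆⁆ n = ∑ a : Fin N, ∑ b : Fin N, ∑ c : Fin N,
      if (a : ℕ) + b + c + 2 = n then ⁅f a, ⁅g b, h c⁆⁆ else 0 := by
  rw [lie_apply]
  refine Finset.sum_congr rfl fun a _ => ?_
  calc _ = ∑ m : Fin N, ∑ b : Fin N, ∑ c : Fin N, (if (a : ℕ) + m + 1 = n then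
        (if (b : ℕ) + c + 1 = m then ⁅f a, ⁅g b, h c⁆⁆ else 0) else 0) := by
        refine Finset.sum_congr rfl fun m _ => ?_
        split_ifs with h1
        · simp only [lie_apply, lie_sum, apply_ite (fun x => ⁅f a, x⁆), lie_zero]
        · simp
    _ = _ := by
        rw [Finset.sum_comm]
        refine Finset.sum_congr rfl fun b _ => ?_
        rw [Finset.sum_comm]
        exact Finset.sum_congr rfl fun c _ => sum_ite_shift a b c n _

theorem lie_lie_apply' (f g h : TruncSeries N L) (n : Fin N) :
    ⁅⁅f, g⁆, h⁆ n = ∑ a : Fin N, ∑ b : Fin N, ∑ c : Fin N,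
      if (a : ℕ) + b + c + 2 = n then ⁅⁅f a, g b⁆, h c⁆ else 0 := by
  rw [lie_apply]
  calc _ = ∑ m : Fin N, ∑ c : Fin N, ∑ a : Fin N, ∑ b : Fin N, (if (c : ℕ) + m + 1 = n then
        (if (a : ℕ) + b + 1 = m then ⁅⁅f a, g b⁆, h c⁆ else 0) else 0) := by
        refine Finset.sum_congr rfl fun m _ => Finset.sum_congr rfl fun c _ => ?_
        rw [show (m : ℕ) + c + 1 = c + m + 1 by ring]
        split_ifs with h1
        · simp only [lie_apply, sum_lie, apply_ite (fun x => ⁅x, h c⁆), zero_lie]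
        · simp
    _ = ∑ c : Fin N, ∑ a : Fin N, ∑ b : Fin N, ∑ m : Fin N, (if (c : ℕ) + m + 1 = n then
        (if (a : ℕ) + b + 1 = m then ⁅⁅f a, g b⁆, h c⁆ else 0) else 0) := by
        rw [Finset.sum_comm]
        refine Finset.sum_congr rfl fun c _ => ?_
        rw [Finset.sum_comm]
        refine Finset.sum_congr rfl fun a _ => ?_
        rw [Finset.sum_comm]
    _ = ∑ c : Fin N, ∑ a : Fin N, ∑ b : Fin N,
          if (a : ℕ) + b + c + 2 = n then ⁅⁅f a, g b⁆, h c⁆ else 0 := by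
        refine Finset.sum_congr rfl fun c _ => Finset.sum_congr rfl fun a _ =>
          Finset.sum_congr rfl fun b _ => ?_
        rw [sum_ite_shift, show (c : ℕ) + a + b + 2 = a + b + c + 2 by ring]
    _ = _ := by
        rw [Finset.sum_comm]
        refine Finset.sum_congr rfl fun a _ => ?_
        rw [Finset.sum_comm]

instance : LieRing (TruncSeries N L) where
  add_lie f g h := by
    ext n
    simp only [lie_apply, add_apply, add_lie, ← Finset.sum_add_distrib]
    refine Finset.sum_congr rfl fun i _ => Finset.sum_congr rfl fun j _ => ?_
    split_ifs <;> simp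
  lie_add f g h := by
    ext n
    simp only [lie_apply, add_apply, lie_add, ← Finset.sum_add_distrib]
    refine Finset.sum_congr rfl fun i _ => Finset.sum_congr rfl fun j _ => ?_
    split_ifs <;> simp
  lie_self f := by
    ext n
    -- Exchanging the two indices and using skewness makes the coefficient its own negative; complex
    -- scalars allow division by `2`.
    have key : ⁅f, f⁆ n = -(⁅f, f⁆ n) := by
      conv_lhs => rw [lie_apply, Finset.sum_comm]
      rw [lie_apply, ← Finset.sum_neg_distrib]
      refine Finset.sum_congr rfl fun i _ => ?_
      rw [← Finset.sum_neg_distrib]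
      refine Finset.sum_congr rfl fun j _ => ?_
      rw [show (j : ℕ) + i + 1 = i + j + 1 by ring]
      split_ifs
      · rw [lie_skew]
      · simp
    have h2 : (2 : ℂ) • (⁅f, f⁆ n) = 0 := by
      rw [two_smul]; nth_rewrite 1 [key]; simp
    simpa using h2
  leibniz_lie f g h := by
    ext n
    rw [add_apply, lie_lie_apply, lie_lie_apply', lie_lie_apply]
    rw [Finset.sum_comm (f := fun (b a : Fin N) => ∑ c : Fin N,
      if (b : ℕ) + a + c + 2 = n then ⁅g b, ⁅f a, h c⁆⁆ else 0)]
    simp only [← Finset.sum_add_distrib]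
    refine Finset.sum_congr rfl fun a _ => Finset.sum_congr rfl fun b _ =>
      Finset.sum_congr rfl fun c _ => ?_
    rw [show (b : ℕ) + a + c + 2 = a + b + c + 2 by ring]
    split_ifs
    · exact leibniz_lie _ _ _
    · simp

instance : LieAlgebra ℂ (TruncSeries N L) where
  lie_smul c f g := by
    ext n
    simp only [lie_apply, smul_apply, lie_smul, Finset.smul_sum]
    refine Finset.sum_congr rfl fun i _ => Finset.sum_congr rfl fun j _ => ?_
    split_ifs <;> simp

/-- The Euler derivation, multiplying the coefficient of degree `n` by `n`. -/
def euler : Module.End ℂ (TruncSeries N L) where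
  toFun f := fun n : Fin N => ((n : ℕ) + 1 : ℂ) • f n
  map_add' _ _ := funext fun _ => smul_add _ _ _
  map_smul' _ _ := funext fun _ => smul_comm _ _ _

@[simp] theorem euler_apply (f : TruncSeries N L) (n : Fin N) :
    euler f n = ((n : ℕ) + 1 : ℂ) • f n := rfl

/-- Degrees add under the bracket: index `i` has degree `i + 1`, and `(i + 1) + (j + 1) = n + 1`. -/
theorem euler_lie (f g : TruncSeries N L) : euler ⁅f, g⁆ = ⁅euler f, g⁆ + ⁅f, euler g⁆ := by
  ext n
  simp only [lie_apply, euler_apply, add_apply, Finset.smul_sum, ← Finset.sum_add_distrib]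
  refine Finset.sum_congr rfl fun i _ => Finset.sum_congr rfl fun j _ => ?_
  split_ifs with h
  · rw [smul_lie, lie_smul, ← add_smul, ← h]
    congr 1; push_cast; ring
  · simp

/-- The inverse of the Euler derivation. -/
noncomputable def eulerInv (f : TruncSeries N L) : TruncSeries N L := fun n => ((n : ℕ) + 1 : ℂ)⁻¹ • f n

theorem euler_eulerInv (f : TruncSeries N L) : euler (eulerInv f) = f := by
  ext n
  have : ((n : ℕ) + 1 : ℂ) ≠ 0 := Nat.cast_add_one_ne_zero _
  simp [eulerInv, smul_smul, this]

/-- The series with a single coefficient, of degree `1`. -/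
def degOne (a : L) : TruncSeries N L := fun n => if (n : ℕ) = 0 then a else 0

theorem euler_degOne (a : L) : euler (degOne a : TruncSeries N L) = degOne a := by
  ext n
  simp only [euler_apply, degOne]
  split_ifs with h <;> simp [h]

/-- Equality of the coefficients of degree at most `k`. -/
def AgreeBelow (k : ℕ) (f g : TruncSeries N L) : Prop := ∀ n : Fin N, (n : ℕ) < k → f n = g n

/-- There is no constant term, so a coefficient of a bracket involves only strictly lower
coefficients of both factors. This gain of one degree makes `ad` nilpotent and the fixed-point
iteration for `Z` finite. -/
theorem AgreeBelow.lie {k : ℕ} {f f' g g' : TruncSeries N L} (hf : AgreeBelow k f f')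
    (hg : AgreeBelow k g g') : AgreeBelow (k + 1) ⁅f, g⁆ ⁅f', g'⁆ := by
  intro n hn
  rw [lie_apply, lie_apply]
  refine Finset.sum_congr rfl fun i _ => Finset.sum_congr rfl fun j _ => ?_
  split_ifs with h
  · rw [hf i (by omega), hg j (by omega)]
  · rfl

theorem AgreeBelow.mono {k l : ℕ} {f g : TruncSeries N L} (h : AgreeBelow l f g) (hkl : k ≤ l) :
    AgreeBelow k f g := fun n hn => h n (by omega)

theorem lie_eq_zero_below {k : ℕ} (f : TruncSeries N L) {g : TruncSeries N L}
    (hg : AgreeBelow k g 0) : AgreeBelow (k + 1) ⁅f, g⁆ 0 := by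
  intro n hn
  rw [lie_apply]
  refine Finset.sum_eq_zero fun i _ => Finset.sum_eq_zero fun j _ => ?_
  split_ifs with h
  · rw [hg j (by omega)]; simp
  · rfl

theorem ad_pow_below (f g : TruncSeries N L) (k : ℕ) :
    AgreeBelow k ((LieAlgebra.ad ℂ _ f ^ k) g) 0 := by
  induction k with
  | zero => intro n hn; omega
  | succ k ih =>
    rw [pow_succ', Module.End.mul_apply, LieAlgebra.ad_apply]
    exact lie_eq_zero_below f ih

theorem ad_pow_eq_zero (f : TruncSeries N L) {k : ℕ} (hk : N ≤ k) :
    LieAlgebra.ad ℂ (TruncSeries N L) f ^ k = 0 := by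
  ext1 g
  ext n
  exact ad_pow_below f g k n (by omega)

end TruncSeries

/-! ### Conjugation by the exponential of a nilpotent element. -/

/-- The exponential series truncated after `N` terms, which is the exponential of an element whose
`N`-th power vanishes. -/
noncomputable def expTrunc {A : Type*} [Ring A] [Algebra ℂ A] (N : ℕ) (a : A) : A :=
  ∑ k ∈ Finset.range N, ((k.factorial : ℂ))⁻¹ • a ^ k

section Conjugation

variable {A : Type*} [Ring A] [Algebra ℂ A]

/-- Left multiplication by `z` is right multiplication by `z` plus the commutator with `z`. The last
two commute, so the binomial theorem applies. -/
theorem pow_mul_eq_sum_commutator (z b : A) (c : ℕ → A) (h0 : c 0 = b)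
    (hc : ∀ k, c (k + 1) = z * c k - c k * z) (n : ℕ) :
    z ^ n * b = ∑ p ∈ Finset.HasAntidiagonal.antidiagonal n, n.choose p.1 • (c p.2 * z ^ p.1) := by
  set D : Module.End ℂ A := LinearMap.mulLeft ℂ z - LinearMap.mulRight ℂ z with hD
  have hcomm : Commute (LinearMap.mulRight ℂ z) D := by
    refine Commute.sub_right ?_ (Commute.refl _)
    exact (LinearMap.commute_mulLeft_right z z).symm
  have hDc : ∀ k, (D ^ k) b = c k := by
    intro k
    induction k with
    | zero => simp [h0]
    | succ k ih => rw [pow_succ', Module.End.mul_apply, ih, hc]; simp [hD]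
  have h := congrArg (fun T : Module.End ℂ A => T b) (hcomm.add_pow' n)
  simp only [hD, add_sub_cancel] at h
  rw [LinearMap.pow_mulLeft] at h
  simp only [LinearMap.mulLeft_apply] at h
  rw [h, LinearMap.sum_apply]
  refine Finset.sum_congr rfl fun p _ => ?_
  rw [LinearMap.smul_apply, Module.End.mul_apply, ← hD, hDc, LinearMap.pow_mulRight]
  simp

theorem sum_range_mul_sum_range_eq {M : Type*} [AddCommMonoid M] (F : ℕ → ℕ → M) (S : ℕ)
    (hF : ∀ i j, S ≤ i ∨ S ≤ j → F i j = 0) :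
    ∑ n ∈ Finset.range (2 * S), ∑ p ∈ Finset.HasAntidiagonal.antidiagonal n, F p.1 p.2
      = ∑ i ∈ Finset.range S, ∑ j ∈ Finset.range S, F i j := by
  rw [← Finset.sum_product' (f := F)]
  rw [← Finset.sum_fiberwise_of_maps_to (s := Finset.range S ×ˢ Finset.range S)
    (t := Finset.range (2 * S)) (g := fun p : ℕ × ℕ => p.1 + p.2)]
  · refine Finset.sum_congr rfl fun n _ => (Finset.sum_subset ?_ ?_).symm
    · intro p hp
      simp only [Finset.mem_filter] at hp
      simpa using hp.2
    · intro p hp hp'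
      simp only [Finset.mem_filter, Finset.mem_product, Finset.mem_range,
        Finset.HasAntidiagonal.mem_antidiagonal] at hp hp'
      apply hF
      by_contra hcon
      push Not at hcon
      exact hp' ⟨hcon, hp⟩
  · intro p hp
    simp only [Finset.mem_product, Finset.mem_range] at hp ⊢
    omega

theorem expTrunc_eq_of_le {N M : ℕ} (hNM : N ≤ M) {z : A} (hz : ∀ k, N ≤ k → z ^ k = 0) :
    expTrunc M z = expTrunc N z := by
  refine (Finset.sum_subset (by simpa using hNM) fun k _ hk => ?_).symm
  rw [hz k (by simpa using hk), smul_zero]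

/-- This is `exp(z) b exp(-z) = exp(ad z) b`, written without inverses. The commutators need only
vanish beyond `N`, one place later than the powers of `z`; the application to the Euler derivation
needs this margin. -/
theorem expTrunc_mul_eq {N : ℕ} (z b : A) (c : ℕ → A) (h0 : c 0 = b)
    (hc : ∀ k, c (k + 1) = z * c k - c k * z) (hz : ∀ k, N ≤ k → z ^ k = 0)
    (hcN : ∀ k, N < k → c k = 0) :
    expTrunc N z * b
      = (∑ i ∈ Finset.range (N + 1), ((i.factorial : ℂ))⁻¹ • c i) * expTrunc N z := by
  have hz' : ∀ k, N + 1 ≤ k → z ^ k = 0 := fun k hk => hz k (by omega)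
  have key := sum_range_mul_sum_range_eq
    (fun i j => (((i.factorial : ℂ))⁻¹ • z ^ i, ((j.factorial : ℂ))⁻¹ • c j)
      |> fun p : A × A => p.2 * p.1) (N + 1) (by
      rintro i j (h | h)
      · simp [hz' i h]
      · simp [hcN j (by omega)])
  -- The extra terms vanish; with them the antidiagonals cover the whole square of pairs of
  -- exponents.
  calc expTrunc N z * b = expTrunc (2 * (N + 1)) z * b := by
        rw [expTrunc_eq_of_le (N := N) (M := 2 * (N + 1)) (by omega) hz]
    _ = ∑ n ∈ Finset.range (2 * (N + 1)), ∑ p ∈ Finset.HasAntidiagonal.antidiagonal n,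
          (((p.2.factorial : ℂ))⁻¹ • c p.2) * (((p.1.factorial : ℂ))⁻¹ • z ^ p.1) := by
        rw [expTrunc, Finset.sum_mul]
        refine Finset.sum_congr rfl fun n _ => ?_
        rw [smul_mul_assoc, pow_mul_eq_sum_commutator z b c h0 hc, Finset.smul_sum]
        refine Finset.sum_congr rfl fun p hp => ?_
        rw [Finset.HasAntidiagonal.mem_antidiagonal] at hp
        rw [smul_mul_smul_comm, ← Nat.cast_smul_eq_nsmul ℂ, smul_smul]
        congr 1
        rw [← hp, Nat.choose_symm_add, Nat.add_choose, Nat.cast_div (Nat.factorial_mul_factorial_dvd_factorial_add _ _)]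
        · have h1 := Nat.factorial_ne_zero p.1
          have h2 := Nat.factorial_ne_zero p.2
          have h3 := Nat.factorial_ne_zero (p.1 + p.2)
          push_cast
          field_simp
        · exact_mod_cast mul_ne_zero (Nat.factorial_ne_zero _) (Nat.factorial_ne_zero _)
    _ = _ := by
        rw [key, Finset.sum_comm, ← expTrunc_eq_of_le (Nat.le_succ N) hz, expTrunc,
          Finset.sum_mul_sum]

end Conjugation

/-! ### The Baker–Campbell–Hausdorff formula by means of the Euler derivation. -/

namespace TruncSeries

variable {N : ℕ} {L : Type*} [LieRing L] [LieAlgebra ℂ L]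

/-- The exponential of the adjoint action. -/
noncomputable def expAd (f : TruncSeries N L) : Module.End ℂ (TruncSeries N L) :=
  expTrunc N (LieAlgebra.ad ℂ _ f)

theorem expAd_apply (f g : TruncSeries N L) :
    expAd f g = ∑ k ∈ Finset.range N, ((k.factorial : ℂ))⁻¹ • (LieAlgebra.ad ℂ _ f ^ k) g := by
  simp [expAd, expTrunc, LinearMap.sum_apply]

/-- `((exp x - 1) / x) (ad Z)` applied to `f`. -/
noncomputable def dexp (Z f : TruncSeries N L) : TruncSeries N L :=
  ∑ k ∈ Finset.range N, (((k + 1).factorial : ℂ))⁻¹ • (LieAlgebra.ad ℂ _ Z ^ k) f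

theorem ad_ad_pow (f g : TruncSeries N L) (k : ℕ) :
    LieAlgebra.ad ℂ _ ((LieAlgebra.ad ℂ _ f ^ (k + 1)) g)
      = LieAlgebra.ad ℂ _ f * LieAlgebra.ad ℂ _ ((LieAlgebra.ad ℂ _ f ^ k) g)
        - LieAlgebra.ad ℂ _ ((LieAlgebra.ad ℂ _ f ^ k) g) * LieAlgebra.ad ℂ _ f := by
  ext1 h
  rw [pow_succ', Module.End.mul_apply, LinearMap.sub_apply, Module.End.mul_apply,
    Module.End.mul_apply]
  simp only [LieAlgebra.ad_apply]
  exact lie_lie f _ h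

theorem expAd_mul_ad (f g : TruncSeries N L) :
    expAd f * LieAlgebra.ad ℂ _ g = LieAlgebra.ad ℂ _ (expAd f g) * expAd f := by
  rw [expAd, expTrunc_mul_eq _ _ (fun k => LieAlgebra.ad ℂ _ ((LieAlgebra.ad ℂ _ f ^ k) g))
    (by simp) (ad_ad_pow f g) (fun k hk => ad_pow_eq_zero f hk)
    (fun k hk => by rw [ad_pow_eq_zero f hk.le]; simp)]
  congr 1
  rw [Finset.sum_range_succ, ad_pow_eq_zero f le_rfl, ← expAd, expAd_apply, map_sum]
  simp

theorem euler_mul_ad (f : TruncSeries N L) :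
    euler * LieAlgebra.ad ℂ _ f = LieAlgebra.ad ℂ _ f * euler + LieAlgebra.ad ℂ _ (euler f) := by
  ext1 g
  simp [Module.End.mul_apply, euler_lie, add_comm]

/-- The Euler derivation plays the role of `t d/dt`, and `dexp f (euler f)` is the logarithmic
derivative of the exponential. It characterises the exponential through a linear differential
equation. -/
theorem euler_mul_expAd (f : TruncSeries N L) :
    euler * expAd f = expAd f * euler + LieAlgebra.ad ℂ _ (dexp f (euler f)) * expAd f := by
  have h := expTrunc_mul_eq (N := N) (LieAlgebra.ad ℂ _ f) euler
    -- The commutator of `ad f` with `euler` is `-ad (euler f)`; later commutators only apply more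
    -- powers of `ad f` inside.
    (fun k => match k with
      | 0 => euler
      | k + 1 => -LieAlgebra.ad ℂ _ ((LieAlgebra.ad ℂ _ f ^ k) (euler f))) rfl
    (fun k => by
      cases k with
      | zero => simp [euler_mul_ad]
      | succ k => simp only [ad_ad_pow]; noncomm_ring)
    (fun k hk => ad_pow_eq_zero f hk)
    (fun k hk => by
      cases k with
      | zero => omega
      | succ k => simp only [ad_pow_eq_zero f (Nat.lt_succ_iff.1 hk)]; simp)
  rw [Finset.sum_range_succ'] at h
  rw [expAd, h, dexp, map_sum]
  simp only [smul_neg, Finset.sum_neg_distrib, Nat.factorial_zero, Nat.cast_one, inv_one, one_smul,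
    map_smul]
  noncomm_ring

/-- A linear map is unipotent when it preserves the leading coefficient. -/
def IsUnipotent (V : Module.End ℂ (TruncSeries N L)) : Prop :=
  ∀ k f, AgreeBelow k f 0 → AgreeBelow (k + 1) (V f) f

theorem AgreeBelow.ad_pow {k : ℕ} (f : TruncSeries N L) {g : TruncSeries N L}
    (hg : AgreeBelow k g 0) (i : ℕ) : AgreeBelow (k + i) ((LieAlgebra.ad ℂ _ f ^ i) g) 0 := by
  induction i with
  | zero => simpa using hg
  | succ i ih =>
    rw [pow_succ', Module.End.mul_apply, LieAlgebra.ad_apply]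
    exact lie_eq_zero_below f ih

theorem isUnipotent_expAd (f : TruncSeries N L) : IsUnipotent (expAd f) := by
  intro k g hg n hn
  obtain ⟨N', rfl⟩ : ∃ N', N = N' + 1 := ⟨N - 1, by have := n.2; omega⟩
  rw [expAd_apply, Finset.sum_range_succ', add_apply, sum_apply, Finset.sum_eq_zero]
  · simp
  · intro i _
    rw [smul_apply, AgreeBelow.ad_pow f hg (i + 1) n (by omega)]
    simp

theorem IsUnipotent.mul {V W : Module.End ℂ (TruncSeries N L)} (hV : IsUnipotent V)
    (hW : IsUnipotent W) : IsUnipotent (V * W) := by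
  intro k f hf n hn
  have h1 := hW k f hf
  have h2 : AgreeBelow k (W f) 0 := fun m hm => by rw [h1 m (by omega), hf m hm]
  rw [Module.End.mul_apply, hV k _ h2 n hn, h1 n hn]

/-- Uniqueness for the linear equation `[euler, V] = ad C · V`. For the difference `T`, the entry
from degree `m` to degree `n` is multiplied by `n - m` on the left, while the right side involves
only lower entries. Induction kills the entries with `n ≠ m`; unipotence kills those with `n = m`,
where the equation says nothing. -/
theorem eq_of_euler_mul_eq {V W : Module.End ℂ (TruncSeries N L)} {C : TruncSeries N L}
    (hV : euler * V = V * euler + LieAlgebra.ad ℂ _ C * V)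
    (hW : euler * W = W * euler + LieAlgebra.ad ℂ _ C * W)
    (uV : IsUnipotent V) (uW : IsUnipotent W) : V = W := by
  set T := V - W with hT
  have hTe : euler * T = T * euler + LieAlgebra.ad ℂ _ C * T := by
    rw [hT, mul_sub, hV, hW]; noncomm_ring
  obtain ⟨single, hsame, hother⟩ : ∃ single : Fin N → L → TruncSeries N L,
      (∀ m y, single m y m = y) ∧ ∀ n m y, n ≠ m → single m y n = 0 :=
    ⟨fun m y n => if n = m then y else 0, fun m y => if_pos rfl, fun n m y h => if_neg h⟩
  have heul : ∀ m y, euler (single m y) = ((m : ℕ) + 1 : ℂ) • single m y := by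
    intro m y
    ext n
    rw [euler_apply, smul_apply]
    by_cases h : n = m
    · subst h; rfl
    · rw [hother n m y h]; simp
  have key : ∀ (k : ℕ) (m : Fin N) (y : L), AgreeBelow k (T (single m y)) 0 := by
    intro k
    induction k with
    | zero => intro m y n hn; omega
    | succ k ih =>
      intro m y n hn
      have h := congrArg (fun S : Module.End ℂ (TruncSeries N L) => S (single m y) n) hTe
      simp only [LinearMap.add_apply, Module.End.mul_apply, heul, map_smul, euler_apply, add_apply,
        smul_apply, LieAlgebra.ad_apply] at h
      rw [lie_eq_zero_below C (ih m y) n hn] at h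
      simp only [zero_apply, add_zero] at h
      by_cases hnm : n = m
      · subst hnm
        have hs : AgreeBelow (n : ℕ) (single n y) 0 := by
          intro i hi
          exact hother i n y (by intro hh; rw [hh] at hi; omega)
        rw [hT, LinearMap.sub_apply, sub_apply, uV _ _ hs n (by omega), uW _ _ hs n (by omega)]
        simp
      · have hne : ((n : ℕ) : ℂ) - (m : ℕ) ≠ 0 := by
          rw [sub_ne_zero]
          exact fun hh => hnm (Fin.ext (by exact_mod_cast hh))
        have h2 : (((n : ℕ) : ℂ) - (m : ℕ)) • (T (single m y) n) = 0 := by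
          have := sub_eq_zero.2 h
          rw [← sub_smul] at this
          simpa using this
        simpa [hne] using h2
  rw [← sub_eq_zero, ← hT]
  ext1 f
  have hf : f = ∑ m, single m (f m) := by
    ext n
    rw [sum_apply]
    exact ((Finset.sum_eq_single n (f := fun m => single m (f m) n)
      (fun m _ hm => hother n m _ hm.symm) (fun h => absurd (Finset.mem_univ n) h)).trans
      (hsame n (f n))).symm
  rw [hf, map_sum]
  refine Finset.sum_eq_zero fun m _ => ?_
  ext n
  exact key N m _ n n.2

theorem dexp_self {f g : TruncSeries N L} (h : ⁅f, g⁆ = 0) : dexp f g = g := by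
  rcases N with _ | N
  · ext n; exact n.elim0
  · rw [dexp, Finset.sum_range_succ', Finset.sum_eq_zero]
    · simp
    · intro k _
      rw [pow_succ, Module.End.mul_apply, LieAlgebra.ad_apply, h]
      simp

theorem expAd_self {f g : TruncSeries N L} (h : ⁅f, g⁆ = 0) : expAd f g = g := by
  rcases N with _ | N
  · ext n; exact n.elim0
  · rw [expAd_apply, Finset.sum_range_succ', Finset.sum_eq_zero]
    · simp
    · intro k _
      rw [pow_succ, Module.End.mul_apply, LieAlgebra.ad_apply, h]
      simp

/-- A form of the Baker–Campbell–Hausdorff formula. -/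
theorem expAd_eq_mul (a p : L) (Z : TruncSeries N L)
    (hZ : dexp Z (euler Z) = degOne a + expAd (degOne a) (degOne p)) :
    expAd Z = expAd (degOne a) * expAd (degOne p) := by
  refine eq_of_euler_mul_eq (euler_mul_expAd Z) ?_ (isUnipotent_expAd Z)
    ((isUnipotent_expAd _).mul (isUnipotent_expAd _))
  -- By the product rule the logarithmic derivative of `exp(ad A) exp(ad P)` is `A + exp(ad A) P`,
  -- the second summand coming from moving `ad P` to the left of `exp(ad A)`.
  rw [hZ, ← mul_assoc, euler_mul_expAd, euler_degOne, dexp_self (lie_self _), add_mul, mul_assoc,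
    euler_mul_expAd, euler_degOne, dexp_self (lie_self _), mul_add, ← mul_assoc _ _ (expAd _),
    ← mul_assoc _ _ (expAd _), expAd_mul_ad, map_add]
  noncomm_ring

theorem expAd_expAd_eq_self (a p : L) (Z : TruncSeries N L)
    (hZ : dexp Z (euler Z) = degOne a + expAd (degOne a) (degOne p)) :
    expAd (degOne a) (expAd (degOne p) Z) = Z := by
  rw [← Module.End.mul_apply, ← expAd_eq_mul a p Z hZ, expAd_self (lie_self Z)]

end TruncSeries

/-! ### Estimates for the Baker–Campbell–Hausdorff series. -/

namespace TruncSeries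

variable {N : ℕ} {L : Type*} [LieRing L] [LieAlgebra ℂ L]

theorem dexp_sub_self (Z f : TruncSeries (N + 1) L) :
    dexp Z f - f = ∑ k ∈ Finset.range N,
      (((k + 2).factorial : ℂ))⁻¹ • (LieAlgebra.ad ℂ _ Z ^ (k + 1)) f := by
  rw [dexp, Finset.sum_range_succ']
  simp

theorem dexp_add (Z f g : TruncSeries N L) : dexp Z (f + g) = dexp Z f + dexp Z g := by
  simp [dexp, Finset.sum_add_distrib]

section Seminorm

/-- A seminorm for which the bracket is bounded by `κ` and the inverse of the Euler derivation
by `1`. -/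
structure IsLieBound (q : Seminorm ℂ (TruncSeries N L)) (κ : ℝ) : Prop where
  nonneg : 0 ≤ κ
  lie : ∀ f g, q ⁅f, g⁆ ≤ κ * q f * q g
  euler : ∀ f, q f ≤ q (euler f)

variable {q : Seminorm ℂ (TruncSeries N L)} {κ : ℝ}

theorem IsLieBound.ad_pow (hq : IsLieBound q κ) (Z f : TruncSeries N L) (k : ℕ) :
    q ((LieAlgebra.ad ℂ _ Z ^ k) f) ≤ (κ * q Z) ^ k * q f := by
  induction k with
  | zero => simp
  | succ k ih =>
    rw [pow_succ', Module.End.mul_apply, LieAlgebra.ad_apply]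
    refine (hq.lie _ _).trans ?_
    rw [pow_succ', mul_assoc (κ * q Z)]
    exact mul_le_mul_of_nonneg_left ih (mul_nonneg hq.nonneg (apply_nonneg q _))

theorem norm_inv_factorial_le_half (k : ℕ) : ‖(((k + 2).factorial : ℂ))⁻¹‖ ≤ 1 / 2 := by
  rw [norm_inv, Complex.norm_natCast, one_div]
  refine inv_anti₀ two_pos ?_
  have : Nat.factorial 2 ≤ (k + 2).factorial := Nat.factorial_le (by omega)
  exact_mod_cast this

theorem sum_half_pow_le (N : ℕ) : ∑ k ∈ Finset.range N, (1 / 2 : ℝ) ^ k ≤ 2 :=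
  sum_geometric_two_le N

/-- Every factorial coefficient is at most `1/2` and the powers of `ad Z` contribute a geometric
series of ratio `1/2`, of sum at most `2`. -/
theorem IsLieBound.dexp_sub_le {q : Seminorm ℂ (TruncSeries (N + 1) L)} (hq : IsLieBound q κ)
    {Z : TruncSeries (N + 1) L} (hZ : κ * q Z ≤ 1 / 2) (f : TruncSeries (N + 1) L) :
    q (dexp Z f - f) ≤ q ⁅Z, f⁆ := by
  rw [dexp_sub_self]
  have h0 : 0 ≤ κ * q Z := mul_nonneg hq.nonneg (apply_nonneg q _)
  calc _ ≤ ∑ k ∈ Finset.range N, q ((((k + 2).factorial : ℂ))⁻¹ • (LieAlgebra.ad ℂ _ Z ^ (k + 1)) f) :=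
        Finset.le_sum_of_subadditive q (map_zero q).le (map_add_le_add q) _ _
    _ ≤ ∑ k ∈ Finset.range N, 1 / 2 * ((1 / 2 : ℝ) ^ k * q ⁅Z, f⁆) := by
        refine Finset.sum_le_sum fun k _ => ?_
        rw [map_smul_eq_mul, pow_succ, Module.End.mul_apply, LieAlgebra.ad_apply]
        refine mul_le_mul (norm_inv_factorial_le_half k) ((hq.ad_pow _ _ _).trans ?_)
          (apply_nonneg q _) (by norm_num)
        exact mul_le_mul_of_nonneg_right (pow_le_pow_left₀ h0 hZ k) (apply_nonneg q _)
    _ = 1 / 2 * q ⁅Z, f⁆ * ∑ k ∈ Finset.range N, (1 / 2 : ℝ) ^ k := by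
        rw [Finset.mul_sum]; exact Finset.sum_congr rfl fun k _ => by ring
    _ ≤ 1 / 2 * q ⁅Z, f⁆ * 2 := by
        have := apply_nonneg q ⁅Z, f⁆
        exact mul_le_mul_of_nonneg_left (sum_half_pow_le N) (by positivity)
    _ = q ⁅Z, f⁆ := by ring

/-- The terms are bounded separately, not only their sum, because the truncation error along a flow
is a sum of this form. -/
theorem IsLieBound.expAd_le (hq : IsLieBound q κ) {f : TruncSeries N L} (hf : κ * q f ≤ 1 / 2)
    (g : TruncSeries N L) :
    ∑ k ∈ Finset.range N, ‖((k.factorial : ℂ))⁻¹‖ * q ((LieAlgebra.ad ℂ _ f ^ k) g) ≤ 2 * q g := by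
  have h0 : 0 ≤ κ * q f := mul_nonneg hq.nonneg (apply_nonneg q _)
  calc _ ≤ ∑ k ∈ Finset.range N, (1 / 2 : ℝ) ^ k * q g := by
        refine Finset.sum_le_sum fun k _ => ?_
        refine (mul_le_of_le_one_left (apply_nonneg q _) ?_).trans ((hq.ad_pow f g k).trans ?_)
        · rw [norm_inv, Complex.norm_natCast]
          exact inv_le_one_of_one_le₀ (by exact_mod_cast Nat.one_le_iff_ne_zero.2 (Nat.factorial_ne_zero k))
        · exact mul_le_mul_of_nonneg_right (pow_le_pow_left₀ h0 hf k) (apply_nonneg q _)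
    _ ≤ 2 * q g := by
        rw [← Finset.sum_mul]
        exact mul_le_mul_of_nonneg_right (sum_half_pow_le N) (apply_nonneg q _)

theorem IsLieBound.expAd_le' (hq : IsLieBound q κ) {f : TruncSeries N L} (hf : κ * q f ≤ 1 / 2)
    (g : TruncSeries N L) : q (expAd f g) ≤ 2 * q g := by
  refine le_trans ?_ (hq.expAd_le hf g)
  rw [expAd_apply]
  refine (Finset.le_sum_of_subadditive q (map_zero q).le (map_add_le_add q) _ _).trans ?_
  exact (Finset.sum_congr rfl fun k _ => map_smul_eq_mul q _ _).le

end Seminorm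

/-- The map whose fixed points solve `dexp Z (euler Z) = C`. -/
noncomputable def bchStep (C Z : TruncSeries N L) : TruncSeries N L :=
  eulerInv (C - (dexp Z (euler Z) - euler Z))

theorem AgreeBelow.ad_pow_congr {k : ℕ} {Z Z' f f' : TruncSeries N L} (h : AgreeBelow k Z Z')
    (hf : AgreeBelow k f f') (i : ℕ) :
    AgreeBelow k ((LieAlgebra.ad ℂ _ Z ^ i) f) ((LieAlgebra.ad ℂ _ Z' ^ i) f') := by
  induction i with
  | zero => simpa using hf
  | succ i ih =>
    rw [pow_succ', pow_succ', Module.End.mul_apply, Module.End.mul_apply]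
    exact (h.lie ih).mono (Nat.le_succ k)

theorem AgreeBelow.bchStep {k : ℕ} (C : TruncSeries N L) {Z Z' : TruncSeries N L}
    (h : AgreeBelow k Z Z') : AgreeBelow (k + 1) (bchStep C Z) (bchStep C Z') := by
  rcases N with _ | N
  · intro n; exact n.elim0
  have he : AgreeBelow k (euler Z) (euler Z') := fun n hn => by simp [h n hn]
  intro n hn
  have : (dexp Z (euler Z) - euler Z) n = (dexp Z' (euler Z') - euler Z') n := by
    rw [dexp_sub_self, dexp_sub_self, sum_apply, sum_apply]
    refine Finset.sum_congr rfl fun i _ => ?_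
    rw [smul_apply, smul_apply, pow_succ', pow_succ', Module.End.mul_apply, Module.End.mul_apply]
    congr 1
    exact h.lie (h.ad_pow_congr he i) n hn
  simp only [TruncSeries.bchStep, eulerInv]
  rw [sub_apply, sub_apply C, this]

/-- Each iteration from `0` fixes one more coefficient, so `N + 1` iterations reach an exact fixed
point without any smallness. The bound is inherited by all iterates. The seminorm is quantified
after `Z` because the same `Z` is later measured in many graded norms. -/
theorem exists_dexp_euler_eq (C : TruncSeries (N + 1) L) :
    ∃ Z : TruncSeries (N + 1) L, dexp Z (euler Z) = C ∧
      ∀ (q : Seminorm ℂ (TruncSeries (N + 1) L)) (κ : ℝ), IsLieBound q κ → 4 * κ * q C ≤ 1 →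
        q Z ≤ 2 * q C := by
  set it : ℕ → TruncSeries (N + 1) L := fun k => (bchStep C)^[k] 0 with hit
  have hsucc : ∀ k, it (k + 1) = bchStep C (it k) := fun k => Function.iterate_succ_apply' _ _ _
  have hag : ∀ k, AgreeBelow k (it k) (it (k + 1)) := by
    intro k
    induction k with
    | zero => intro n hn; omega
    | succ k ih => rw [hsucc, hsucc (k + 1)]; exact ih.bchStep C
  have hfix : it (N + 1) = bchStep C (it (N + 1)) := by
    rw [← hsucc]
    ext n
    exact hag (N + 1) n n.2
  refine ⟨it (N + 1), ?_, fun q κ hq hC => ?_⟩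
  · have h := congrArg euler hfix
    rw [bchStep, euler_eulerInv] at h
    rw [eq_sub_iff_add_eq] at h
    rw [← h]; abel
  · have hb : ∀ k, q (euler (it k)) ≤ 2 * q C := by
      intro k
      have hC0 := apply_nonneg q C
      induction k with
      | zero => simp [hit]
      | succ k ih =>
        have hk : κ * q (it k) ≤ 1 / 2 := by
          have := mul_le_mul_of_nonneg_left ((hq.euler _).trans ih) hq.nonneg
          linarith
        rw [hsucc, bchStep, euler_eulerInv]
        refine (map_sub_le_add q _ _).trans ?_
        have h1 := (hq.dexp_sub_le hk (euler (it k))).trans (hq.lie _ _)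
        have h2 := mul_le_mul hk ih (apply_nonneg q _) (by norm_num)
        linarith
    exact (hq.euler _).trans (hb _)

/-- The Baker–Campbell–Hausdorff series of two elements, with its basic estimates. -/
theorem exists_bch (N : ℕ) (a p : L) : ∃ Z : TruncSeries (N + 1) L,
    expAd (degOne a) (expAd (degOne p) Z) = Z ∧
    (∀ n : Fin (N + 1), (n : ℕ) = 0 → Z n = a + p) ∧
    (∀ n : Fin (N + 1), (n : ℕ) = 1 → Z n = (2 : ℂ)⁻¹ • ⁅a, p⁆) ∧
    ∀ (q : Seminorm ℂ (TruncSeries (N + 1) L)) (κ : ℝ), IsLieBound q κ →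
      8 * κ * (q (degOne a) + 2 * q (degOne p)) ≤ 1 →
        q Z ≤ 2 * (q (degOne a) + 2 * q (degOne p)) ∧ q (Z - degOne a) ≤ 6 * q (degOne p) := by
  set A : TruncSeries (N + 1) L := degOne a with hA
  set P : TruncSeries (N + 1) L := degOne p with hP
  obtain ⟨Z, hZ, hq⟩ := exists_dexp_euler_eq (A + expAd A P)
  have h0 : ∀ n : Fin (N + 1), (n : ℕ) = 0 → Z n = a + p := by
    intro n hn
    have h := congrArg (fun f : TruncSeries (N + 1) L => f n) hZ
    simp only [dexp, expAd_apply, sum_apply, add_apply] at h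
    rw [Finset.sum_range_succ', Finset.sum_range_succ', Finset.sum_eq_zero, Finset.sum_eq_zero] at h
    · simpa [hn, hA, hP, degOne] using h
    · intro i _
      rw [smul_apply, ad_pow_below A P (i + 1) n (by omega)]; simp
    · intro i _
      rw [smul_apply, ad_pow_below Z _ (i + 1) n (by omega)]; simp
  refine ⟨Z, expAd_expAd_eq_self a p Z hZ, h0, ?_, ?_⟩
  · intro n hn
    obtain ⟨N', rfl⟩ : ∃ N', N = N' + 1 := ⟨N - 1, by have := n.2; omega⟩
    -- In degree two the correction `½ [Z, euler Z]` reduces to `½ [Z 0, Z 0] = 0`, so the equation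
    -- reads `2 Z 1 = [a, p]`.
    have hlie : ∀ f g : TruncSeries (N' + 1 + 1) L, ⁅f, g⁆ n = ⁅f 0, g 0⁆ := by
      intro f g
      rw [lie_apply, Finset.sum_eq_single 0, Finset.sum_eq_single 0]
      · simp [hn]
      · intro j _ hj
        rw [if_neg]
        intro h
        exact hj (Fin.ext (by simp only [Fin.val_zero] at h ⊢; omega))
      · simp
      · intro i _ hi
        refine Finset.sum_eq_zero fun j _ => ?_
        rw [if_neg]
        intro h
        exact hi (Fin.ext (by simp only [Fin.val_zero]; omega))
      · simp
    have h := congrArg (fun f : TruncSeries (N' + 1 + 1) L => f n) hZ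
    simp only [dexp, expAd_apply, sum_apply, add_apply] at h
    rw [Finset.sum_range_succ', Finset.sum_range_succ', Finset.sum_range_succ',
      Finset.sum_range_succ', Finset.sum_eq_zero, Finset.sum_eq_zero] at h
    · have hA0 : A n = 0 := by simp [hA, degOne, hn]
      have hP0 : P n = 0 := by simp [hP, degOne, hn]
      have hAz : A 0 = a := by simp [hA, degOne]
      have hPz : P 0 = p := by simp [hP, degOne]
      simp [hlie, hn, hA0, hP0, hAz, hPz] at h
      rw [← h, smul_smul]
      norm_num
    · intro i _
      rw [smul_apply, ad_pow_below A P (i + 1 + 1) n (by omega)]; simp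
    · intro i _
      rw [smul_apply, ad_pow_below Z _ (i + 1 + 1) n (by omega)]; simp
  · intro q κ hκ hs
    have hqA := apply_nonneg q A
    have hqP := apply_nonneg q P
    have hκ0 := hκ.nonneg
    have hκA : κ * q A ≤ 1 / 8 := by nlinarith [mul_nonneg hκ0 hqP]
    have hE : q (expAd A P) ≤ 2 * q P := hκ.expAd_le' (by linarith) P
    have hC : q (A + expAd A P) ≤ q A + 2 * q P := (map_add_le_add q _ _).trans (by linarith)
    have hCk := mul_le_mul_of_nonneg_left hC hκ0
    have hqZ : q Z ≤ 2 * (q A + 2 * q P) := (hq q κ hκ (by nlinarith)).trans (by linarith)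
    have hκZ : κ * q Z ≤ 1 / 2 := by
      have := mul_le_mul_of_nonneg_left hqZ hκ0
      linarith
    refine ⟨hqZ, ?_⟩
    set S := Z - A with hS
    have hZS : Z = S + A := by rw [hS]; abel
    have heZ : euler Z = euler S + A := by rw [hZS, map_add, hA, euler_degOne]
    have hSe := hκ.euler S
    have h1 : q (dexp Z (euler S) - euler S) ≤ 1 / 2 * q (euler S) :=
      ((hκ.dexp_sub_le hκZ _).trans (hκ.lie _ _)).trans
        (mul_le_mul_of_nonneg_right hκZ (apply_nonneg q _))
    -- Since `[A, A] = 0`, only `S = Z - A` enters the bracket. Hence `S` is controlled by `P`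
    -- alone, which is much smaller than `A` in the application.
    have h2 : q (dexp Z A - A) ≤ 1 / 8 * q (euler S) := by
      refine (hκ.dexp_sub_le hκZ _).trans ?_
      have : ⁅Z, A⁆ = ⁅S, A⁆ := by rw [hZS, add_lie, lie_self, add_zero]
      rw [this]
      refine (hκ.lie _ _).trans ?_
      have h3 := mul_le_mul_of_nonneg_right hκA (apply_nonneg q S)
      linarith
    have h3 : euler S = expAd A P - (dexp Z (euler S) - euler S) - (dexp Z A - A) := by
      rw [heZ, dexp_add] at hZ
      have : expAd A P = dexp Z (euler S) + dexp Z A - A := by rw [hZ]; abel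
      rw [this]; abel
    -- Absorbing `5/8` on the left gives the factor `16/3`, which is at most `6`.
    have h4 : q (euler S) ≤ 2 * q P + 1 / 2 * q (euler S) + 1 / 8 * q (euler S) := by
      calc q (euler S) = q (expAd A P - (dexp Z (euler S) - euler S) - (dexp Z A - A)) := by
            rw [← h3]
        _ ≤ q (expAd A P) + q (dexp Z (euler S) - euler S) + q (dexp Z A - A) :=
            (map_sub_le_add q _ _).trans (add_le_add_left (map_sub_le_add q _ _) _)
        _ ≤ _ := by linarith
    linarith

end TruncSeries

/-! ### The Lie algebra of Hamiltonian functions on a symplectic Banach space. -/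

/-- A (weakly nondegenerate) symplectic form of norm at most one. -/
structure SymplecticForm (E : Type*) [NormedAddCommGroup E] [NormedSpace ℂ E] where
  form : E →L[ℂ] E →L[ℂ] ℂ
  antisymm : ∀ u v, form u v = -form v u
  nondegenerate : ∀ u, (∀ v, form u v = 0) → u = 0
  norm_le : ∀ u v, ‖form u v‖ ≤ ‖u‖ * ‖v‖

variable {E : Type*} [NormedAddCommGroup E] [NormedSpace ℂ E]

/-- Cauchy's estimate on the complex line through `z` in the direction `v`, on the disc of radius `δ
/ ‖v‖`. -/
theorem norm_fderiv_apply_le {F : Type*} [NormedAddCommGroup F] [NormedSpace ℂ F]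
    {X : E → F} (hX : Differentiable ℂ X) {r δ b : ℝ}
    (hδ : 0 < δ) (hb : ∀ z, ‖z‖ ≤ r + δ → ‖X z‖ ≤ b) {z : E} (hz : ‖z‖ ≤ r) (v : E) :
    ‖fderiv ℂ X z v‖ ≤ b / δ * ‖v‖ := by
  rcases eq_or_ne v 0 with rfl | hv
  · simp
  have hv' : 0 < ‖v‖ := norm_pos_iff.2 hv
  have hline : Differentiable ℂ (fun w : ℂ => X (z + w • v)) :=
    hX.comp ((differentiable_const z).add (differentiable_id.smul_const v))
  have hd : deriv (fun w : ℂ => X (z + w • v)) 0 = fderiv ℂ X z v := by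
    have h1 : HasDerivAt (fun w : ℂ => z + w • v) v 0 := by
      simpa using ((hasDerivAt_id (0 : ℂ)).smul_const v).const_add z
    have h2 : HasFDerivAt X (fderiv ℂ X z) (z + (0 : ℂ) • v) := by
      simpa using (hX z).hasFDerivAt
    exact (h2.comp_hasDerivAt (0 : ℂ) h1).deriv
  have h := Complex.norm_deriv_le_of_forall_mem_sphere_norm_le (c := 0) (R := δ / ‖v‖) (C := b)
    (div_pos hδ hv') hline.diffContOnCl (fun w hw => hb _ (by
      have hw' : ‖w‖ = δ / ‖v‖ := by simpa using hw
      calc ‖z + w • v‖ ≤ ‖z‖ + ‖w‖ * ‖v‖ := (norm_add_le _ _).trans_eq (by rw [norm_smul])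
        _ ≤ r + δ := by rw [hw', div_mul_cancel₀ _ hv'.ne']; linarith))
  rw [hd] at h
  refine h.trans_eq ?_
  field_simp

/-- The Hamiltonian functions vanishing at the origin, paired with their Hamiltonian vector fields,
which are required to be smooth, bounded on bounded sets and zero at the origin. -/
def hamiltonianPairs (Ω : SymplecticForm E) : Submodule ℂ ((E → ℂ) × (E → E)) where
  carrier := {p | p.1 0 = 0 ∧ p.2 0 = 0 ∧ ContDiff ℂ (⊤ : ℕ∞) p.2 ∧
    (∀ z, HasFDerivAt p.1 (Ω.form (p.2 z)) z) ∧
    ∀ r : ℝ, ∃ b : ℝ, ∀ z, ‖z‖ ≤ r → ‖p.2 z‖ ≤ b}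
  add_mem' := by
    rintro p p' ⟨h1, h2, h3, h4, h5⟩ ⟨h1', h2', h3', h4', h5'⟩
    refine ⟨by simp [h1, h1'], by simp [h2, h2'], h3.add h3', fun z => ?_, fun r => ?_⟩
    · have := (h4 z).add (h4' z)
      rw [← map_add] at this
      exact this
    · obtain ⟨b, hb⟩ := h5 r
      obtain ⟨b', hb'⟩ := h5' r
      exact ⟨b + b', fun z hz => (norm_add_le _ _).trans (add_le_add (hb z hz) (hb' z hz))⟩
  zero_mem' := by
    refine ⟨rfl, rfl, contDiff_const, fun z => ?_, fun r => ⟨0, fun z _ => by simp⟩⟩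
    rw [Prod.snd_zero, Pi.zero_apply, map_zero]
    exact hasFDerivAt_const (0 : ℂ) z
  smul_mem' := by
    rintro c p ⟨h1, h2, h3, h4, h5⟩
    refine ⟨by simp [h1], by simp [h2], h3.const_smul c, fun z => ?_, fun r => ?_⟩
    · have := (h4 z).const_smul c
      rw [← map_smul] at this
      exact this
    · obtain ⟨b, hb⟩ := h5 r
      refine ⟨‖c‖ * b, fun z hz => ?_⟩
      rw [Prod.smul_snd, Pi.smul_apply, norm_smul]
      exact mul_le_mul_of_nonneg_left (hb z hz) (norm_nonneg c)

/-- The Lie algebra of Hamiltonian functions. -/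
abbrev HamFun (Ω : SymplecticForm E) : Type _ := hamiltonianPairs Ω

namespace HamFun

variable {Ω : SymplecticForm E}

/-- The value of a Hamiltonian function. -/
def val (F : HamFun Ω) : E → ℂ := F.1.1

/-- The Hamiltonian vector field. -/
def field (F : HamFun Ω) : E → E := F.1.2

theorem val_zero (F : HamFun Ω) : F.val 0 = 0 := F.2.1
theorem field_zero (F : HamFun Ω) : F.field 0 = 0 := F.2.2.1
theorem contDiff_field (F : HamFun Ω) : ContDiff ℂ (⊤ : ℕ∞) F.field := F.2.2.2.1
theorem hasFDerivAt (F : HamFun Ω) (z : E) : HasFDerivAt F.val (Ω.form (F.field z)) z :=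
  F.2.2.2.2.1 z
theorem exists_bound (F : HamFun Ω) (r : ℝ) : ∃ b : ℝ, ∀ z, ‖z‖ ≤ r → ‖F.field z‖ ≤ b :=
  F.2.2.2.2.2 r

theorem differentiable_field (F : HamFun Ω) : Differentiable ℂ F.field :=
  F.contDiff_field.differentiable (by simp)

@[simp] theorem add_val (F G : HamFun Ω) (z : E) : (F + G).val z = F.val z + G.val z := rfl
@[simp] theorem add_field (F G : HamFun Ω) (z : E) : (F + G).field z = F.field z + G.field z := rfl
@[simp] theorem smul_val (c : ℂ) (F : HamFun Ω) (z : E) : (c • F).val z = c • F.val z := rfl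
@[simp] theorem smul_field (c : ℂ) (F : HamFun Ω) (z : E) : (c • F).field z = c • F.field z := rfl
@[simp] theorem zero_apply_val (z : E) : (0 : HamFun Ω).val z = 0 := rfl

/-- Nondegeneracy lets the function determine its field, so Lie algebra identities need checking on
values only. -/
theorem ext_val {F G : HamFun Ω} (h : ∀ z, F.val z = G.val z) : F = G := by
  have hv : F.val = G.val := funext h
  refine Subtype.ext (Prod.ext hv (funext fun z => ?_))
  have h1 := F.hasFDerivAt z
  rw [hv] at h1
  have h2 := h1.unique (G.hasFDerivAt z)
  rw [← sub_eq_zero]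
  refine Ω.nondegenerate _ fun v => ?_
  change Ω.form (F.field z - G.field z) v = 0
  rw [map_sub, h2, sub_self]
  rfl

/-- Both sides are the second derivative of `F.val`, which is symmetric. This yields the field of a
bracket and the Jacobi identity. -/
theorem form_fderiv_symm (F : HamFun Ω) (z u v : E) :
    Ω.form (fderiv ℂ F.field z u) v = Ω.form (fderiv ℂ F.field z v) u := by
  have h : HasFDerivAt (fun y => Ω.form (F.field y)) (Ω.form.comp (fderiv ℂ F.field z)) z :=
    Ω.form.hasFDerivAt.comp z (F.differentiable_field z).hasFDerivAt
  exact second_derivative_symmetric F.hasFDerivAt h u v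

/-- The bound on a ball of the derivative of a vector field along another one. -/
theorem norm_fderiv_field_le (F G : HamFun Ω) {r δ a b : ℝ} (hδ : 0 < δ)
    (ha : ∀ z, ‖z‖ ≤ r + δ → ‖F.field z‖ ≤ a) (hb : ∀ z, ‖z‖ ≤ r + δ → ‖G.field z‖ ≤ b) {z : E}
    (hz : ‖z‖ ≤ r) : ‖fderiv ℂ G.field z (F.field z)‖ ≤ a * b / δ := by
  refine (norm_fderiv_apply_le G.differentiable_field hδ hb hz _).trans ?_
  have hb0 : 0 ≤ b := (norm_nonneg _).trans (hb z (by linarith))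
  calc b / δ * ‖F.field z‖ ≤ b / δ * a :=
        mul_le_mul_of_nonneg_left (ha z (by linarith)) (by positivity)
    _ = a * b / δ := by ring

/-- The Poisson bracket: the derivative of `G` along the flow of `F`. -/
noncomputable instance : Bracket (HamFun Ω) (HamFun Ω) where
  bracket F G := ⟨(fun z => Ω.form (G.field z) (F.field z),
    fun z => fderiv ℂ G.field z (F.field z) - fderiv ℂ F.field z (G.field z)), by
    refine ⟨by simp [field_zero], by simp [field_zero], ?_, fun z => ?_, fun r => ?_⟩
    · exact ((G.contDiff_field.fderiv_right (by simp)).clm_apply F.contDiff_field).sub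
        ((F.contDiff_field.fderiv_right (by simp)).clm_apply G.contDiff_field)
    · have h1 : HasFDerivAt (fun y => Ω.form (G.field y)) (Ω.form.comp (fderiv ℂ G.field z)) z :=
        Ω.form.hasFDerivAt.comp z (G.differentiable_field z).hasFDerivAt
      have h2 := h1.clm_apply (F.differentiable_field z).hasFDerivAt
      refine h2.congr_fderiv (ContinuousLinearMap.ext fun v => ?_)
      simp only [map_sub, sub_apply, add_apply, ContinuousLinearMap.comp_apply,
        ContinuousLinearMap.flip_apply]
      rw [form_fderiv_symm G z v, form_fderiv_symm F z _ v, Ω.antisymm (G.field z)]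
      ring
    · obtain ⟨a, ha⟩ := F.exists_bound (r + 1)
      obtain ⟨b, hb⟩ := G.exists_bound (r + 1)
      exact ⟨a * b / 1 + b * a / 1, fun z hz => (norm_sub_le _ _).trans
        (add_le_add (norm_fderiv_field_le F G one_pos ha hb hz)
          (norm_fderiv_field_le G F one_pos hb ha hz))⟩⟩

theorem lie_val (F G : HamFun Ω) (z : E) : ⁅F, G⁆.val z = Ω.form (G.field z) (F.field z) := rfl

theorem lie_field (F G : HamFun Ω) (z : E) : ⁅F, G⁆.field z
    = fderiv ℂ G.field z (F.field z) - fderiv ℂ F.field z (G.field z) := rfl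

noncomputable instance : LieRing (HamFun Ω) where
  add_lie F G H := ext_val fun z => by simp [lie_val]
  lie_add F G H := ext_val fun z => by simp [lie_val]
  lie_self F := ext_val fun z => by
    have h := Ω.antisymm (F.field z) (F.field z)
    rw [lie_val, zero_apply_val]
    exact self_eq_neg.1 h
  leibniz_lie F G H := ext_val fun z => by
    rw [add_val, lie_val, lie_val, lie_val, Ω.antisymm (H.field z)]
    simp only [lie_field, map_sub, sub_apply]
    rw [form_fderiv_symm H z (F.field z) (G.field z), form_fderiv_symm F z (G.field z) (H.field z),
      form_fderiv_symm G z (H.field z) (F.field z)]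
    ring

noncomputable instance : LieAlgebra ℂ (HamFun Ω) where
  lie_smul c F G := ext_val fun z => by simp [lie_val]

theorem bddAbove_norm_field (F : HamFun Ω) (r : ℝ) :
    BddAbove (Set.range fun z : Metric.closedBall (0 : E) r => ‖F.field z‖) := by
  obtain ⟨b, hb⟩ := F.exists_bound r
  refine ⟨b, ?_⟩
  rintro _ ⟨z, rfl⟩
  exact hb z (mem_closedBall_zero_iff.1 z.2)

/-- The supremum norm of the vector field on a ball. -/
noncomputable def supNorm (Ω : SymplecticForm E) (r : ℝ) : Seminorm ℂ (HamFun Ω) :=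
  Seminorm.of (fun F => ⨆ z : Metric.closedBall (0 : E) r, ‖F.field z‖)
    (fun F G => Real.iSup_le (fun z => (norm_add_le _ _).trans
        (add_le_add (le_ciSup (F.bddAbove_norm_field r) z) (le_ciSup (G.bddAbove_norm_field r) z)))
      (add_nonneg (Real.iSup_nonneg fun _ => norm_nonneg _)
        (Real.iSup_nonneg fun _ => norm_nonneg _)))
    (fun c F => by
      simp only [smul_field, norm_smul]
      exact (Real.mul_iSup_of_nonneg (norm_nonneg c) _).symm)

theorem norm_field_le (F : HamFun Ω) {r : ℝ} {z : E} (hz : ‖z‖ ≤ r) :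
    ‖F.field z‖ ≤ supNorm Ω r F :=
  le_ciSup (F.bddAbove_norm_field r) ⟨z, mem_closedBall_zero_iff.2 hz⟩

theorem supNorm_le (F : HamFun Ω) {r b : ℝ} (hb : 0 ≤ b) (h : ∀ z, ‖z‖ ≤ r → ‖F.field z‖ ≤ b) :
    supNorm Ω r F ≤ b :=
  Real.iSup_le (fun z => h z (mem_closedBall_zero_iff.1 z.2)) hb

theorem supNorm_mono (F : HamFun Ω) {r r' : ℝ} (h : r ≤ r') : supNorm Ω r F ≤ supNorm Ω r' F :=
  F.supNorm_le (apply_nonneg _ _) fun _ hz => F.norm_field_le (hz.trans h)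

theorem supNorm_lie_le (F G : HamFun Ω) {r δ : ℝ} (hδ : 0 < δ) :
    supNorm Ω r ⁅F, G⁆ ≤ 2 / δ * supNorm Ω (r + δ) F * supNorm Ω (r + δ) G := by
  have hF := apply_nonneg (supNorm Ω (r + δ)) F
  have hG := apply_nonneg (supNorm Ω (r + δ)) G
  refine supNorm_le _ (by positivity) fun z hz => ?_
  rw [lie_field]
  refine (norm_sub_le _ _).trans ((add_le_add
    (norm_fderiv_field_le F G hδ (fun _ => F.norm_field_le) (fun _ => G.norm_field_le) hz)
    (norm_fderiv_field_le G F hδ (fun _ => G.norm_field_le) (fun _ => F.norm_field_le) hz)).trans_eq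
    ?_)
  ring

theorem norm_val_le (F : HamFun Ω) {r : ℝ} {z : E} (hz : ‖z‖ ≤ r) :
    ‖F.val z‖ ≤ supNorm Ω r F * ‖z‖ := by
  have h := (convex_closedBall (0 : E) r).norm_image_sub_le_of_norm_hasFDerivWithin_le
    (𝕜 := ℂ) (f := F.val) (f' := fun w => Ω.form (F.field w)) (C := supNorm Ω r F)
    (fun w _ => (F.hasFDerivAt w).hasFDerivWithinAt)
    (fun w hw => ContinuousLinearMap.opNorm_le_bound _ (apply_nonneg _ _) fun v =>
      (Ω.norm_le _ _).trans (mul_le_mul_of_nonneg_right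
        (F.norm_field_le (mem_closedBall_zero_iff.1 hw)) (norm_nonneg v)))
    (x := 0) (y := z)
    (mem_closedBall_zero_iff.2 (by rw [norm_zero]; exact (norm_nonneg z).trans hz))
    (mem_closedBall_zero_iff.2 hz)
  simpa [F.val_zero] using h

theorem norm_lie_val_le (F G : HamFun Ω) (z : E) :
    ‖⁅F, G⁆.val z‖ ≤ ‖F.field z‖ * ‖G.field z‖ := by
  rw [lie_val, mul_comm]
  exact Ω.norm_le _ _

/-- The derivative of `G` along a solution of the Hamiltonian system of `F`. -/
theorem hasDerivWithinAt_val (F G : HamFun Ω) {φ : ℝ → E} {s : Set ℝ} {t : ℝ}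
    (h : HasDerivWithinAt φ (F.field (φ t)) s t) :
    HasDerivWithinAt (fun τ => G.val (φ τ)) (⁅F, G⁆.val (φ t)) s t := by
  have h1 := ((G.hasFDerivAt (φ t)).restrictScalars ℝ).comp_hasDerivWithinAt t h
  exact h1

end HamFun

/-! ### Graded norms on shrinking balls and the almost invariant function. -/

variable {E : Type*} [NormedAddCommGroup E] [NormedSpace ℂ E]

namespace HamFun

variable {Ω : SymplecticForm E} {N : ℕ}

/-- Evaluation at a point, as a linear map. -/
def valₗ (Ω : SymplecticForm E) (z : E) : HamFun Ω →ₗ[ℂ] ℂ where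
  toFun F := F.val z
  map_add' _ _ := rfl
  map_smul' _ _ := rfl

theorem sum_val {ι : Type*} (s : Finset ι) (F : ι → HamFun Ω) (z : E) :
    (∑ i ∈ s, F i).val z = ∑ i ∈ s, (F i).val z :=
  map_sum (valₗ Ω z) F s

/-- The sum of the coefficients of a truncated series. -/
noncomputable def total : TruncSeries N (HamFun Ω) →ₗ[ℂ] HamFun Ω := ∑ i : Fin N, TruncSeries.coeffₗ i

theorem total_apply (Y : TruncSeries N (HamFun Ω)) :
    total Y = ∑ i : Fin N, TruncSeries.coeffₗ i Y :=
  LinearMap.sum_apply _ _ _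

/-- Bracketing with `P` shifts degrees by one. Only the top coefficient falls outside the truncated
series, and it is the sole source of error. -/
theorem lie_total (P : HamFun Ω) (Y : TruncSeries (N + 1) (HamFun Ω)) :
    ⁅P, total Y⁆ = total ⁅(TruncSeries.degOne P : TruncSeries (N + 1) (HamFun Ω)), Y⁆
      + ⁅P, Y (Fin.last N)⁆ := by
  have h0 : ⁅(TruncSeries.degOne P : TruncSeries (N + 1) (HamFun Ω)), Y⁆ 0 = 0 := by
    rw [TruncSeries.lie_apply]
    refine Finset.sum_eq_zero fun i _ => Finset.sum_eq_zero fun j _ => if_neg ?_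
    simp
  have hs : ∀ n : Fin N, ⁅(TruncSeries.degOne P : TruncSeries (N + 1) (HamFun Ω)), Y⁆ n.succ
      = ⁅P, Y n.castSucc⁆ := by
    intro n
    rw [TruncSeries.lie_apply, Finset.sum_eq_single 0, Finset.sum_eq_single n.castSucc]
    · simp [TruncSeries.degOne]
    · intro j _ hj
      rw [if_neg]
      intro h
      exact hj (Fin.ext (by simp only [Fin.val_zero, Fin.val_succ, Fin.val_castSucc] at h ⊢; omega))
    · simp
    · intro i _ hi
      refine Finset.sum_eq_zero fun j _ => ?_
      have : (i : ℕ) ≠ 0 := fun h => hi (Fin.ext h)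
      simp [TruncSeries.degOne, this]
    · simp
  rw [total_apply, total_apply, Fin.sum_univ_castSucc, lie_add, lie_sum, Fin.sum_univ_succ]
  have h0' := (TruncSeries.coeffₗ_apply 0 _).trans h0
  rw [h0', zero_add]
  congr 1
  exact Finset.sum_congr rfl fun n _ => (hs n).symm

/-- The weighted sum of the supremum norms of the first `n` coefficients, on balls that shrink
from radius `R + δ` to radius `R`. -/
noncomputable def gradedNorm (Ω : SymplecticForm E) (N n : ℕ) (R δ : ℝ) (x : NNReal) :
    Seminorm ℂ (TruncSeries N (HamFun Ω)) :=
  ∑ i : Fin N, (if (i : ℕ) < n then x ^ ((i : ℕ) + 1) else 0) •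
    (supNorm Ω (R + δ * (1 - ((i : ℕ) + 1) / n))).comp (TruncSeries.coeffₗ i)

variable {n : ℕ} {R δ : ℝ} {x : NNReal}

theorem gradedNorm_apply (Y : TruncSeries N (HamFun Ω)) : gradedNorm Ω N n R δ x Y
    = ∑ i : Fin N, if (i : ℕ) < n then
        (x : ℝ) ^ ((i : ℕ) + 1) * supNorm Ω (R + δ * (1 - ((i : ℕ) + 1) / n)) (Y i) else 0 := by
  have h : ∀ (s : Finset (Fin N)) (p : Fin N → Seminorm ℂ (TruncSeries N (HamFun Ω))),
      (∑ i ∈ s, p i) Y = ∑ i ∈ s, p i Y := fun s p =>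
    map_sum (⟨⟨fun q => q Y, rfl⟩, fun _ _ => rfl⟩ :
      Seminorm ℂ (TruncSeries N (HamFun Ω)) →+ ℝ) p s
  rw [gradedNorm, h]
  refine Finset.sum_congr rfl fun i _ => ?_
  rw [smul_apply]
  split_ifs <;> simp [NNReal.smul_def]

theorem coeff_le_gradedNorm (hδ : 0 < δ) (Y : TruncSeries N (HamFun Ω)) (i : Fin N)
    (hi : (i : ℕ) < n) : (x : ℝ) ^ ((i : ℕ) + 1) * supNorm Ω R (Y i) ≤ gradedNorm Ω N n R δ x Y := by
  rw [gradedNorm_apply]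
  refine le_trans ?_ (Finset.single_le_sum (f := fun i : Fin N => if (i : ℕ) < n then
    (x : ℝ) ^ ((i : ℕ) + 1) * supNorm Ω (R + δ * (1 - ((i : ℕ) + 1) / n)) (Y i) else 0)
    (fun j _ => ?_) (Finset.mem_univ i))
  · simp only [if_pos hi]
    refine mul_le_mul_of_nonneg_left (supNorm_mono _ ?_) (by positivity)
    have hn : (0 : ℝ) < n := by exact_mod_cast (by omega : 0 < n)
    have : ((i : ℕ) + 1 : ℝ) / n ≤ 1 := by
      rw [div_le_one hn]; exact_mod_cast hi
    nlinarith
  · split_ifs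
    · exact mul_nonneg (by positivity) (apply_nonneg _ _)
    · exact le_rfl

theorem gradedNorm_degOne_le (hδ : 0 < δ) (F : HamFun Ω) :
    gradedNorm Ω N n R δ x (TruncSeries.degOne F) ≤ x * supNorm Ω (R + δ) F := by
  rw [gradedNorm_apply]
  have h0 : 0 ≤ (x : ℝ) * supNorm Ω (R + δ) F := mul_nonneg x.2 (apply_nonneg _ _)
  rcases N with _ | N
  · simpa using h0
  rw [Finset.sum_eq_single 0]
  · split_ifs with h
    · simp only [TruncSeries.degOne, Fin.val_zero, if_true, zero_add, pow_one, Nat.cast_zero]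
      refine mul_le_mul_of_nonneg_left (supNorm_mono _ ?_) x.2
      have : (0 : ℝ) ≤ 1 / n := by positivity
      nlinarith
    · exact h0
  · intro i _ hi
    have : (i : ℕ) ≠ 0 := fun h => hi (Fin.ext h)
    simp [TruncSeries.degOne, this]
  · simp

/-- The bracket of the coefficients of index `i` and `j` has index `i + j + 1`, larger than both, so
its ball is smaller by at least `δ / n` and Cauchy's estimate costs `2n / δ`. The weights multiply
exactly, since degrees add. -/
theorem isLieBound_gradedNorm (hδ : 0 < δ) (hn : 0 < n) :
    TruncSeries.IsLieBound (gradedNorm Ω N n R δ x) (2 * n / δ) where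
  nonneg := by positivity
  euler f := by
    rw [gradedNorm_apply, gradedNorm_apply]
    refine Finset.sum_le_sum fun i _ => ?_
    split_ifs
    · refine mul_le_mul_of_nonneg_left ?_ (by positivity)
      rw [TruncSeries.euler_apply, map_smul_eq_mul]
      refine le_mul_of_one_le_left (apply_nonneg _ _) ?_
      rw [← Nat.cast_add_one, Complex.norm_natCast]
      exact_mod_cast Nat.le_add_left _ _
    · exact le_rfl
  lie f g := by
    have hn' : (0 : ℝ) < n := by exact_mod_cast hn
    rw [gradedNorm_apply, gradedNorm_apply, gradedNorm_apply]
    set ρ : ℕ → ℝ := fun i => R + δ * (1 - ((i : ℝ) + 1) / n) with hρ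
    set u : TruncSeries N (HamFun Ω) → Fin N → ℝ := fun h i =>
      if (i : ℕ) < n then (x : ℝ) ^ ((i : ℕ) + 1) * supNorm Ω (ρ i) (h i) else 0 with hu
    have hu0 : ∀ h i, 0 ≤ u h i := by
      intro h i
      simp only [hu]
      split_ifs
      · exact mul_nonneg (by positivity) (apply_nonneg _ _)
      · exact le_rfl
    have hterm : ∀ m i j : Fin N, (m : ℕ) < n → (i : ℕ) + j + 1 = m →
        (x : ℝ) ^ ((m : ℕ) + 1) * supNorm Ω (ρ m) ⁅f i, g j⁆ ≤ 2 * n / δ * u f i * u g j := by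
      intro m i j hm hij
      have hgap : ∀ k : Fin N, (k : ℕ) + 1 ≤ m → ρ m + δ / n ≤ ρ k := by
        intro k hk
        have hk' : (k : ℝ) + 1 ≤ (m : ℕ) := by exact_mod_cast hk
        have h1 : ((k : ℝ) + 1) / n ≤ (m : ℕ) / n := div_le_div_of_nonneg_right hk' hn'.le
        have h2 : δ / n = δ * (1 / n) := by ring
        have h3 : (((m : ℕ) : ℝ) + 1) / n = (m : ℕ) / n + 1 / n := by ring
        simp only [hρ]
        rw [h2, h3]
        nlinarith
      have hl := supNorm_lie_le (Ω := Ω) (f i) (g j) (r := ρ m) (δ := δ / n) (by positivity)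
      have h1 := supNorm_mono (f i) (hgap i (by omega))
      have h2 := supNorm_mono (g j) (hgap j (by omega))
      simp only [hu]
      rw [if_pos (by omega), if_pos (by omega)]
      have h3 : 2 / (δ / n) = 2 * n / δ := by field_simp
      rw [h3] at hl
      calc (x : ℝ) ^ ((m : ℕ) + 1) * supNorm Ω (ρ m) ⁅f i, g j⁆
          ≤ (x : ℝ) ^ ((m : ℕ) + 1) * (2 * n / δ * supNorm Ω (ρ i) (f i) * supNorm Ω (ρ j) (g j)) := by
            refine mul_le_mul_of_nonneg_left (hl.trans ?_) (by positivity)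
            exact mul_le_mul (mul_le_mul_of_nonneg_left h1 (by positivity)) h2 (apply_nonneg _ _)
              (mul_nonneg (by positivity) (apply_nonneg _ _))
        _ = _ := by
            rw [← hij]; ring
    calc (∑ m : Fin N, if (m : ℕ) < n then
            (x : ℝ) ^ ((m : ℕ) + 1) * supNorm Ω (ρ m) (⁅f, g⁆ m) else 0)
        ≤ ∑ m : Fin N, ∑ i : Fin N, ∑ j : Fin N,
            (if (i : ℕ) + j + 1 = m then 2 * n / δ * u f i * u g j else 0) := by
          refine Finset.sum_le_sum fun m _ => ?_
          split_ifs with hm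
          · rw [TruncSeries.lie_apply]
            refine (mul_le_mul_of_nonneg_left (Finset.le_sum_of_subadditive (supNorm Ω (ρ m))
              (map_zero _).le (map_add_le_add _) _ _) (by positivity)).trans ?_
            rw [Finset.mul_sum]
            refine Finset.sum_le_sum fun i _ => ?_
            refine (mul_le_mul_of_nonneg_left (Finset.le_sum_of_subadditive (supNorm Ω (ρ m))
              (map_zero _).le (map_add_le_add _) _ _) (by positivity)).trans ?_
            rw [Finset.mul_sum]
            refine Finset.sum_le_sum fun j _ => ?_
            split_ifs with hij
            · exact hterm m i j hm hij
            · simp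
          · refine Finset.sum_nonneg fun i _ => Finset.sum_nonneg fun j _ => ?_
            split_ifs
            · exact mul_nonneg (mul_nonneg (by positivity) (hu0 _ _)) (hu0 _ _)
            · exact le_rfl
      _ = ∑ i : Fin N, ∑ j : Fin N, ∑ m : Fin N,
            (if (i : ℕ) + j + 1 = m then 2 * n / δ * u f i * u g j else 0) := by
          rw [Finset.sum_comm]
          exact Finset.sum_congr rfl fun i _ => Finset.sum_comm
      _ ≤ ∑ i : Fin N, ∑ j : Fin N, 2 * n / δ * u f i * u g j := by
          refine Finset.sum_le_sum fun i _ => Finset.sum_le_sum fun j _ => ?_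
          have h0 : 0 ≤ 2 * n / δ * u f i * u g j :=
            mul_nonneg (mul_nonneg (by positivity) (hu0 _ _)) (hu0 _ _)
          by_cases hij : (i : ℕ) + j + 1 < N
          · rw [Finset.sum_eq_single (⟨(i : ℕ) + j + 1, hij⟩ : Fin N)]
            · simp
            · intro m _ hm
              exact if_neg fun h => hm (Fin.ext h.symm)
            · simp
          · rw [Finset.sum_eq_zero]
            · exact h0
            · intro m _
              exact if_neg fun h => hij (by have := m.2; omega)
      _ = 2 * n / δ * (∑ i, u f i) * ∑ j, u g j := by
          rw [mul_assoc, Finset.sum_mul_sum, Finset.mul_sum]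
          refine Finset.sum_congr rfl fun i _ => ?_
          rw [Finset.mul_sum]
          exact Finset.sum_congr rfl fun j _ => by ring

/-- Along a solution of the Hamiltonian system of `P`, a truncated series evolves by the
exponential of the adjoint action, up to the truncation error. -/
theorem norm_total_sub_total_expAd_le (P : HamFun Ω) (Y : TruncSeries (N + 1) (HamFun Ω))
    {φ : ℝ → E} {R : ℝ}
    (hφ : ∀ t ∈ Set.Icc (0 : ℝ) 1, HasDerivWithinAt φ (P.field (φ t)) (Set.Icc 0 1) t)
    (hφR : ∀ t ∈ Set.Icc (0 : ℝ) 1, ‖φ t‖ ≤ R) :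
    ‖(total Y).val (φ 1) - (total (TruncSeries.expAd (TruncSeries.degOne P) Y)).val (φ 0)‖
      ≤ supNorm Ω R P * ∑ k ∈ Finset.range (N + 1), ‖((k.factorial : ℂ))⁻¹‖ *
        supNorm Ω R ((LieAlgebra.ad ℂ (TruncSeries (N + 1) (HamFun Ω)) (TruncSeries.degOne P) ^ k) Y
          (Fin.last N)) := by
  set y : ℕ → TruncSeries (N + 1) (HamFun Ω) :=
    fun k => (LieAlgebra.ad ℂ (TruncSeries (N + 1) (HamFun Ω)) (TruncSeries.degOne P) ^ k) Y with hy
  have hy1 : ∀ k, y (k + 1)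
      = ⁅(TruncSeries.degOne P : TruncSeries (N + 1) (HamFun Ω)), y k⁆ := by
    intro k
    simp only [hy]
    rw [pow_succ', Module.End.mul_apply, LieAlgebra.ad_apply]
  have hyN : y (N + 1) = 0 := by
    simp only [hy]
    rw [TruncSeries.ad_pow_eq_zero _ le_rfl, LinearMap.zero_apply]
  set c : ℕ → ℂ := fun k => ((k.factorial : ℂ))⁻¹ with hc
  -- A Taylor interpolation between `Y` at the end of the flow and `exp(ad P) Y` at its start. Its
  -- derivative telescopes, leaving only the overflow beyond the top degree.
  set v : ℝ → ℂ := fun t => ∑ k ∈ Finset.range (N + 1),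
    (c k * (1 - (t : ℂ)) ^ k) * (total (y k)).val (φ t) with hv
  have hv1 : v 1 = (total Y).val (φ 1) := by
    simp only [hv]
    rw [Finset.sum_range_succ', Finset.sum_eq_zero]
    · simp [hc, hy]
    · intro k _; simp
  have hv0 : v 0 = (total (TruncSeries.expAd (TruncSeries.degOne P) Y)).val (φ 0) := by
    rw [TruncSeries.expAd_apply, map_sum, sum_val]
    simp only [hv]
    exact Finset.sum_congr rfl fun k _ => by simp [hc, hy]
  have hder : ∀ t ∈ Set.Icc (0 : ℝ) 1, HasDerivWithinAt v
      (∑ k ∈ Finset.range (N + 1), (c k * (1 - (t : ℂ)) ^ k) * ⁅P, y k (Fin.last N)⁆.val (φ t))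
      (Set.Icc 0 1) t := by
    intro t ht
    have h1 : ∀ k ∈ Finset.range (N + 1), HasDerivWithinAt
        (fun t : ℝ => (c k * (1 - (t : ℂ)) ^ k) * (total (y k)).val (φ t))
        (c k * (k * (1 - (t : ℂ)) ^ (k - 1) * (-1)) * (total (y k)).val (φ t)
          + c k * (1 - (t : ℂ)) ^ k * ⁅P, total (y k)⁆.val (φ t)) (Set.Icc 0 1) t := by
      intro k _
      have ha : HasDerivAt (fun t : ℝ => 1 - (t : ℂ)) (-1) t :=
        (Complex.ofRealCLM.hasDerivAt (x := t)).const_sub 1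
      exact ((ha.pow k).const_mul (c k)).hasDerivWithinAt.mul
        (hasDerivWithinAt_val P (total (y k)) (hφ t ht))
    refine (HasDerivWithinAt.fun_sum h1).congr_deriv ?_
    have h2 : ∀ k, ⁅P, total (y k)⁆.val (φ t)
        = (total (y (k + 1))).val (φ t) + ⁅P, y k (Fin.last N)⁆.val (φ t) := by
      intro k
      rw [lie_total, add_val, hy1]
    simp only [h2, mul_add]
    rw [Finset.sum_add_distrib, Finset.sum_add_distrib, ← add_assoc]
    convert zero_add _ using 2
    rw [Finset.sum_range_succ', Finset.sum_range_succ (fun k => c k * (1 - (t : ℂ)) ^ k *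
      (total (y (k + 1))).val (φ t)), hyN]
    have h3 : (total (0 : TruncSeries (N + 1) (HamFun Ω))).val (φ t) = 0 := by
      rw [map_zero, zero_apply_val]
    rw [h3]
    simp only [Nat.cast_zero, zero_mul, mul_zero, add_zero, ← Finset.sum_add_distrib]
    refine Finset.sum_eq_zero fun k _ => ?_
    have h4 : c (k + 1) * ((k : ℂ) + 1) = c k := by
      simp only [hc]
      rw [Nat.factorial_succ]
      have := Nat.factorial_ne_zero k
      have h5 : (k : ℂ) + 1 ≠ 0 := Nat.cast_add_one_ne_zero k
      push_cast
      field_simp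
    simp only [Nat.add_sub_cancel, Nat.cast_add, Nat.cast_one]
    linear_combination (-(1 - (t : ℂ)) ^ k * (total (y (k + 1))).val (φ t)) * h4
  rw [← hv1, ← hv0]
  refine norm_image_sub_le_of_norm_deriv_le_segment_01' hder fun t ht => ?_
  have ht' : t ∈ Set.Icc (0 : ℝ) 1 := ⟨ht.1, ht.2.le⟩
  rw [Finset.mul_sum]
  refine (norm_sum_le _ _).trans (Finset.sum_le_sum fun k _ => ?_)
  rw [norm_mul, norm_mul]
  have h1 : ‖(1 - (t : ℂ)) ^ k‖ ≤ 1 := by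
    rw [norm_pow]
    refine pow_le_one₀ (norm_nonneg _) ?_
    rw [← Complex.ofReal_one, ← Complex.ofReal_sub, Complex.norm_real, Real.norm_eq_abs, abs_le]
    constructor <;> linarith [ht.1, ht.2]
  have h2 : ‖⁅P, y k (Fin.last N)⁆.val (φ t)‖
      ≤ supNorm Ω R P * supNorm Ω R (y k (Fin.last N)) :=
    (norm_lie_val_le _ _ _).trans (mul_le_mul (norm_field_le _ (hφR t ht'))
      (norm_field_le _ (hφR t ht')) (norm_nonneg _) (apply_nonneg _ _))
  calc ‖c k‖ * ‖(1 - (t : ℂ)) ^ k‖ * ‖⁅P, y k (Fin.last N)⁆.val (φ t)‖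
      ≤ ‖c k‖ * 1 * (supNorm Ω R P * supNorm Ω R (y k (Fin.last N))) := by gcongr
    _ = _ := by ring

theorem succ_sq_le_pow (j : ℕ) : ((j : ℝ) + 3) ^ 2 ≤ 9 * 2 ^ j := by
  induction j with
  | zero => norm_num
  | succ j ih => push_cast; rw [pow_succ (2 : ℝ)]; nlinarith [(Nat.cast_nonneg j : (0 : ℝ) ≤ j)]

/-- Two of the factors supply `y ^ 2`; each of the remaining `j` is at most `1/4`. Against `(j + 3)²
≤ 9 · 2 ^ j` this leaves a geometric series of ratio `1/2`, whence `9 · 2 = 18`. -/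
theorem sum_shifted_powers_le {y : ℝ} (hy : 0 ≤ y) (N : ℕ) (hN : ((N : ℝ) + 3) * y ≤ 1 / 4) :
    ∑ j ∈ Finset.range (N + 1), (((j : ℝ) + 3) * y) ^ (j + 2) ≤ 18 * y ^ 2 := by
  calc _ ≤ ∑ j ∈ Finset.range (N + 1), 9 * y ^ 2 * (1 / 2 : ℝ) ^ j := by
        refine Finset.sum_le_sum fun j hj => ?_
        have hjN : (j : ℝ) ≤ N := by exact_mod_cast Nat.lt_succ_iff.1 (Finset.mem_range.1 hj)
        have h1 : ((j : ℝ) + 3) * y ≤ 1 / 4 :=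
          (mul_le_mul_of_nonneg_right (by linarith) hy).trans hN
        calc (((j : ℝ) + 3) * y) ^ (j + 2) = (((j : ℝ) + 3) * y) ^ j * (((j : ℝ) + 3) ^ 2 * y ^ 2) := by
              ring
          _ ≤ (1 / 4) ^ j * (9 * 2 ^ j * y ^ 2) := by
              have := succ_sq_le_pow j
              gcongr
          _ = 9 * y ^ 2 * ((1 / 4 * 2) ^ j) := by rw [mul_pow]; ring
          _ = 9 * y ^ 2 * (1 / 2 : ℝ) ^ j := by norm_num
    _ ≤ 9 * y ^ 2 * 2 := by
        rw [← Finset.mul_sum]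
        exact mul_le_mul_of_nonneg_left (sum_geometric_two_le _) (by positivity)
    _ = 18 * y ^ 2 := by ring

/-- The composition of the time-one flows of two small Hamiltonian systems has an almost invariant
function, up to an exponentially small error, which is close to the sum of the two Hamiltonians. -/
theorem exists_almost_invariant (A P : HamFun Ω) {R δ ε β : ℝ} (hR : 0 ≤ R) (hδ : 0 < δ)
    (hε : 0 < ε) (hε' : supNorm Ω (R + δ) A + 2 * supNorm Ω (R + δ) P ≤ ε)
    (hβ : supNorm Ω (R + δ) P ≤ β) (N : ℕ) (hN : 64 * ((N : ℝ) + 1) * ε ≤ δ) :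
    ∃ K : HamFun Ω,
      (∀ φ ψ : ℝ → E,
        (∀ t ∈ Set.Icc (0 : ℝ) 1, HasDerivWithinAt ψ (A.field (ψ t)) (Set.Icc 0 1) t) →
        (∀ t ∈ Set.Icc (0 : ℝ) 1, HasDerivWithinAt φ (P.field (φ t)) (Set.Icc 0 1) t) →
        (∀ t ∈ Set.Icc (0 : ℝ) 1, ‖ψ t‖ ≤ R) → (∀ t ∈ Set.Icc (0 : ℝ) 1, ‖φ t‖ ≤ R) →
        ψ 1 = φ 0 → ‖K.val (φ 1) - K.val (ψ 0)‖ ≤ 8 * ε ^ 2 * (1 / 4) ^ N) ∧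
      ∀ z, ‖z‖ ≤ R → ‖K.val z - (A.val z + P.val z)‖
        ≤ 1 / 2 * (‖A.field z‖ * ‖P.field z‖) + 108 * β * (16 * ε / δ) ^ 2 * R := by
  obtain ⟨Z, hinv, hZ0, hZ1, hZq⟩ := TruncSeries.exists_bch N A P
  have hA0 := apply_nonneg (supNorm Ω (R + δ)) A
  have hP0 := apply_nonneg (supNorm Ω (R + δ)) P
  have hx : ∀ n : ℕ, 0 ≤ δ / (16 * n * ε) := fun n => by positivity
  -- The largest weight allowed by the smallness condition for the constant `2n / δ`. It is used
  -- with `n = N + 1` for the invariance and with `n = i + 1` for the coefficient of index `i`.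
  set x : ℕ → NNReal := fun n => ⟨δ / (16 * n * ε), hx n⟩ with hxdef
  have hxv : ∀ n, (x n : ℝ) = δ / (16 * n * ε) := fun n => rfl
  have hone : ∀ n, gradedNorm Ω (N + 1) n R δ (x n) (TruncSeries.degOne A)
      + 2 * gradedNorm Ω (N + 1) n R δ (x n) (TruncSeries.degOne P) ≤ x n * ε := by
    intro n
    have h1 := gradedNorm_degOne_le (Ω := Ω) (N := N + 1) (n := n) (R := R) (x := x n) hδ A
    have h2 := gradedNorm_degOne_le (Ω := Ω) (N := N + 1) (n := n) (R := R) (x := x n) hδ P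
    have h3 := mul_le_mul_of_nonneg_left hε' (x n).2
    have h4 : (x n : ℝ) * (supNorm Ω (R + δ) A + 2 * supNorm Ω (R + δ) P) ≤ x n * ε := h3
    linarith
  have hκ : ∀ n : ℕ, 0 < n → 8 * (2 * n / δ) * ((x n : ℝ) * ε) = 1 := by
    intro n hn
    have : (n : ℝ) ≠ 0 := by positivity
    rw [hxv]
    field_simp
    norm_num
  have hest : ∀ n : ℕ, 0 < n → gradedNorm Ω (N + 1) n R δ (x n) Z ≤ 2 * (x n * ε) ∧
      gradedNorm Ω (N + 1) n R δ (x n) (Z - TruncSeries.degOne A)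
        ≤ 6 * gradedNorm Ω (N + 1) n R δ (x n) (TruncSeries.degOne P) := by
    intro n hn
    have h := hZq _ _ (isLieBound_gradedNorm (Ω := Ω) (N := N + 1) (R := R) (x := x n) hδ hn)
      ((mul_le_mul_of_nonneg_left (hone n) (by positivity)).trans (hκ n hn).le)
    exact ⟨h.1.trans (mul_le_mul_of_nonneg_left (hone n) two_pos.le), h.2⟩
  refine ⟨total Z, ?_, ?_⟩
  · intro φ ψ hψ hφ hψR hφR hψφ
    set y : NNReal := x (N + 1) with hy
    set q := gradedNorm Ω (N + 1) (N + 1) R δ y with hq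
    have hlb : TruncSeries.IsLieBound q (2 * ((N + 1 : ℕ) : ℝ) / δ) :=
      isLieBound_gradedNorm hδ (Nat.succ_pos N)
    have hy0 : (0 : ℝ) < y := by
      rw [hy, hxv]; positivity
    have hk := hκ (N + 1) (Nat.succ_pos N)
    have h1 := hone (N + 1)
    have hqA := apply_nonneg q (TruncSeries.degOne A)
    have hqP := apply_nonneg q (TruncSeries.degOne P)
    have hκ0 := hlb.nonneg
    have hκA : 2 * ((N + 1 : ℕ) : ℝ) / δ * q (TruncSeries.degOne A) ≤ 1 / 2 := by
      have := mul_le_mul_of_nonneg_left (show q (TruncSeries.degOne A) ≤ y * ε by linarith) hκ0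
      linarith
    have hκP : 2 * ((N + 1 : ℕ) : ℝ) / δ * q (TruncSeries.degOne P) ≤ 1 / 2 := by
      have := mul_le_mul_of_nonneg_left (show q (TruncSeries.degOne P) ≤ y * ε by linarith) hκ0
      linarith
    have hstep : ∀ (F : HamFun Ω) (Y : TruncSeries (N + 1) (HamFun Ω)) (θ : ℝ → E),
        (∀ t ∈ Set.Icc (0 : ℝ) 1, HasDerivWithinAt θ (F.field (θ t)) (Set.Icc 0 1) t) →
        (∀ t ∈ Set.Icc (0 : ℝ) 1, ‖θ t‖ ≤ R) →
        2 * ((N + 1 : ℕ) : ℝ) / δ * q (TruncSeries.degOne F) ≤ 1 / 2 →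
        (y : ℝ) ^ (N + 1) * ‖(total Y).val (θ 1)
          - (total (TruncSeries.expAd (TruncSeries.degOne F) Y)).val (θ 0)‖
          ≤ supNorm Ω (R + δ) F * (2 * q Y) := by
      intro F Y θ hθ hθR hF
      refine (mul_le_mul_of_nonneg_left (norm_total_sub_total_expAd_le F Y hθ hθR)
        (by positivity)).trans ?_
      rw [mul_left_comm, Finset.mul_sum]
      refine mul_le_mul (supNorm_mono F (by linarith)) ?_ ?_ (apply_nonneg _ _)
      · refine le_trans (Finset.sum_le_sum fun k _ => ?_) (hlb.expAd_le hF Y)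
        rw [mul_left_comm]
        refine mul_le_mul_of_nonneg_left ?_ (norm_nonneg _)
        have := coeff_le_gradedNorm (Ω := Ω) (R := R) (x := y) (n := N + 1) hδ
          ((LieAlgebra.ad ℂ (TruncSeries (N + 1) (HamFun Ω)) (TruncSeries.degOne F) ^ k) Y)
          (Fin.last N) (by simp)
        simpa using this
      · exact Finset.sum_nonneg fun k _ => mul_nonneg (by positivity)
          (mul_nonneg (norm_nonneg _) (apply_nonneg _ _))
    have e1 := hstep P Z φ hφ hφR hκP
    have e2 := hstep A (TruncSeries.expAd (TruncSeries.degOne P) Z) ψ hψ hψR hκA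
    rw [hinv, hψφ] at e2
    have hE : q (TruncSeries.expAd (TruncSeries.degOne P) Z) ≤ 2 * q Z := hlb.expAd_le' hκP Z
    have hqZ : q Z ≤ 2 * (y * ε) := (hest (N + 1) (Nat.succ_pos N)).1
    have hqZ0 := apply_nonneg q Z
    have e3 : (y : ℝ) ^ (N + 1) * ‖(total Z).val (φ 1) - (total Z).val (ψ 0)‖ ≤ 8 * ε ^ 2 * y := by
      have htri := norm_sub_le_norm_sub_add_norm_sub ((total Z).val (φ 1))
        ((total (TruncSeries.expAd (TruncSeries.degOne P) Z)).val (φ 0)) ((total Z).val (ψ 0))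
      have h2 := mul_le_mul_of_nonneg_left htri (show 0 ≤ (y : ℝ) ^ (N + 1) by positivity)
      have h3 : supNorm Ω (R + δ) A *
          (2 * q (TruncSeries.expAd (TruncSeries.degOne P) Z))
          ≤ supNorm Ω (R + δ) A * (2 * (2 * q Z)) :=
        mul_le_mul_of_nonneg_left (by linarith) hA0
      have h4 : (supNorm Ω (R + δ) A + 2 * supNorm Ω (R + δ) P) * q Z ≤ ε * (2 * (y * ε)) :=
        mul_le_mul hε' hqZ hqZ0 hε.le
      have h5 := mul_nonneg hP0 hqZ0
      linarith
    -- This is the hypothesis `64 (N + 1) ε ≤ δ`; each further degree therefore gains a factor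
    -- `1/4`.
    have hy4 : 4 ≤ (y : ℝ) := by
      rw [hy, hxv, le_div_iff₀ (by positivity)]
      push_cast
      linarith
    have e4 : ‖(total Z).val (φ 1) - (total Z).val (ψ 0)‖ * (y : ℝ) ^ N ≤ 8 * ε ^ 2 := by
      have : (‖(total Z).val (φ 1) - (total Z).val (ψ 0)‖ * (y : ℝ) ^ N) * y ≤ 8 * ε ^ 2 * y := by
        refine le_trans (le_of_eq ?_) e3
        ring
      exact le_of_mul_le_mul_right this hy0
    rw [one_div, inv_pow, ← div_eq_mul_inv, le_div_iff₀ (by positivity)]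
    exact (mul_le_mul_of_nonneg_left (pow_le_pow_left₀ (by norm_num) hy4 N)
      (norm_nonneg _)).trans e4
  · intro z hz
    have hβ0 : 0 ≤ β := hP0.trans hβ
    -- Splitting `δ` into only `i + 1` losses gives a bound independent of the truncation order.
    -- Subtracting `A` does not change coefficients of positive index, so `β` replaces `ε`.
    have hcoef : ∀ i : Fin (N + 1), 0 < (i : ℕ) →
        supNorm Ω R (Z i) ≤ 6 * β * (((i : ℕ) + 1) * (16 * ε / δ)) ^ (i : ℕ) := by
      intro i hi
      have h1 := coeff_le_gradedNorm (Ω := Ω) (R := R) (x := x ((i : ℕ) + 1)) (n := (i : ℕ) + 1) hδ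
        (Z - TruncSeries.degOne A) i (Nat.lt_succ_self _)
      have h2 := (hest ((i : ℕ) + 1) (Nat.succ_pos _)).2
      have h3 := gradedNorm_degOne_le (Ω := Ω) (N := N + 1) (n := (i : ℕ) + 1) (R := R)
        (x := x ((i : ℕ) + 1)) hδ P
      have h4 : (Z - TruncSeries.degOne A : TruncSeries (N + 1) (HamFun Ω)) i = Z i := by
        rw [TruncSeries.sub_apply, TruncSeries.degOne, if_neg hi.ne', sub_zero]
      rw [h4] at h1
      have hpos : (0 : ℝ) < x ((i : ℕ) + 1) := by rw [hxv]; positivity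
      have h5 : (x ((i : ℕ) + 1) : ℝ) * ((x ((i : ℕ) + 1) : ℝ) ^ (i : ℕ) * supNorm Ω R (Z i))
          ≤ x ((i : ℕ) + 1) * (6 * β) := by
        have := mul_le_mul_of_nonneg_left hβ hpos.le
        rw [← mul_assoc, ← pow_succ']
        linarith
      have h6 := le_of_mul_le_mul_left h5 hpos
      have h7 : (((i : ℕ) : ℝ) + 1) * (16 * ε / δ) = (x ((i : ℕ) + 1) : ℝ)⁻¹ := by
        rw [hxv]; push_cast; field_simp
      rw [h7, inv_pow, ← div_eq_mul_inv, le_div_iff₀ (by positivity), mul_comm]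
      exact h6
    have hval : ∀ i : Fin (N + 1), 0 < (i : ℕ) →
        ‖(Z i).val z‖ ≤ 6 * β * (((i : ℕ) + 1) * (16 * ε / δ)) ^ (i : ℕ) * R := by
      intro i hi
      have h1 := norm_val_le (Z i) hz
      have h2 := hcoef i hi
      have h3 : 0 ≤ 6 * β * (((i : ℕ) + 1) * (16 * ε / δ)) ^ (i : ℕ) :=
        (apply_nonneg _ _).trans h2
      exact h1.trans (mul_le_mul h2 hz (norm_nonneg _) h3)
    set g : ℕ → ℂ := fun k => if h : k < N + 1 then (Z ⟨k, h⟩).val z else 0 with hg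
    have htot : (total Z).val z = ∑ k ∈ Finset.range (N + 1), g k := by
      rw [total_apply, sum_val, ← Fin.sum_univ_eq_sum_range g]
      refine Finset.sum_congr rfl fun i _ => ?_
      simp only [hg]
      rw [dif_pos i.2]
      rfl
    have hg0 : g 0 = A.val z + P.val z := by
      simp only [hg]
      rw [dif_pos (Nat.succ_pos N), hZ0 _ rfl, add_val]
    have hbase : 0 ≤ 1 / 2 * (‖A.field z‖ * ‖P.field z‖) := by positivity
    have hg1 : ‖g 1‖ ≤ 1 / 2 * (‖A.field z‖ * ‖P.field z‖) := by
      simp only [hg]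
      split_ifs with h
      · rw [hZ1 _ rfl, smul_val, norm_smul]
        have := norm_lie_val_le A P z
        norm_num at this ⊢
        linarith
      · simpa using hbase
    rw [htot]
    rcases N with _ | _ | N
    · simp only [zero_add, Finset.sum_range_one, hg0, sub_self, norm_zero]
      positivity
    · rw [Finset.sum_range_succ, Finset.sum_range_one, hg0, add_sub_cancel_left]
      refine hg1.trans ?_
      have : 0 ≤ 108 * β * (16 * ε / δ) ^ 2 * R := by positivity
      linarith
    · rw [Finset.sum_range_succ', Finset.sum_range_succ', zero_add, hg0]
      have hrest : ‖∑ k ∈ Finset.range (N + 1), g (k + 1 + 1)‖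
          ≤ 108 * β * (16 * ε / δ) ^ 2 * R := by
        have hy0 : 0 ≤ 16 * ε / δ := by positivity
        have hs := sum_shifted_powers_le hy0 N (by
          rw [← mul_div_assoc, div_le_iff₀ hδ]
          push_cast at hN
          linarith)
        calc _ ≤ ∑ k ∈ Finset.range (N + 1), 6 * β * R * (((k : ℝ) + 3) * (16 * ε / δ)) ^ (k + 2) := by
              refine (norm_sum_le _ _).trans (Finset.sum_le_sum fun k hk => ?_)
              have hk' : k + 1 + 1 < N + 1 + 1 + 1 := by
                have := Finset.mem_range.1 hk; omega
              simp only [hg]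
              rw [dif_pos hk']
              refine (hval ⟨k + 1 + 1, hk'⟩ (Nat.succ_pos _)).trans (le_of_eq ?_)
              push_cast
              ring
          _ ≤ 6 * β * R * (18 * (16 * ε / δ) ^ 2) := by
              rw [← Finset.mul_sum]
              exact mul_le_mul_of_nonneg_left hs (by positivity)
          _ = _ := by ring
      calc _ = ‖∑ k ∈ Finset.range (N + 1), g (k + 1 + 1) + g 1‖ := by congr 1; ring
        _ ≤ _ := (norm_add_le _ _).trans (by linarith)

end HamFun

/-! ### Multilinear maps and diagonal operators on `ℓ¹`. -/

section AbsolutelySummable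

variable {I : Type*}

/-- The space of absolutely summable families of complex numbers. -/
abbrev L1 (I : Type*) : Type _ := lp (fun _ : I => ℂ) 1

theorem memℓp_one_of_summable {f : I → ℂ} (hf : Summable fun i => ‖f i‖) : Memℓp f 1 :=
  memℓp_gen (by simpa using hf)

/-- An absolutely summable family as an element of `L1`. -/
def L1.mk (f : I → ℂ) (hf : Summable fun i => ‖f i‖) : L1 I := ⟨f, memℓp_one_of_summable hf⟩

/-- A coordinate of a family. -/
def L1.coord (z : L1 I) (i : I) : ℂ := z i

theorem L1.coord_def (z : L1 I) (i : I) : L1.coord z i = z i := rfl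

@[simp] theorem L1.coord_mk (f : I → ℂ) (hf : Summable fun i => ‖f i‖) (i : I) :
    L1.coord (L1.mk f hf) i = f i := rfl

@[simp] theorem L1.coord_add (z w : L1 I) (i : I) :
    L1.coord (z + w) i = L1.coord z i + L1.coord w i := rfl

@[simp] theorem L1.coord_smul (c : ℂ) (z : L1 I) (i : I) :
    L1.coord (c • z) i = c * L1.coord z i := rfl

@[ext] theorem L1.ext_coord {z w : L1 I} (h : ∀ i, L1.coord z i = L1.coord w i) : z = w :=
  lp.ext (funext h)

theorem L1.summable_norm (z : L1 I) : Summable fun i => ‖L1.coord z i‖ := by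
  simpa [L1.coord_def] using (lp.memℓp z).summable (by norm_num)

theorem L1.norm_eq (z : L1 I) : ‖z‖ = ∑' i, ‖L1.coord z i‖ := by
  simpa [L1.coord_def] using lp.norm_eq_tsum_rpow (p := 1) (by norm_num) z

theorem L1.norm_coord_le (z : L1 I) (i : I) : ‖L1.coord z i‖ ≤ ‖z‖ :=
  lp.norm_apply_le_norm (by norm_num) z i

/-- Evaluation of a coordinate. -/
def L1.evalₗ (i : I) : L1 I →ₗ[ℂ] ℂ where
  toFun z := L1.coord z i
  map_add' _ _ := rfl
  map_smul' _ _ := rfl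

/-- Evaluation of a coordinate, as a continuous map. -/
noncomputable def L1.evalCLM (i : I) : L1 I →L[ℂ] ℂ :=
  (L1.evalₗ i).mkContinuous 1 fun z => by rw [one_mul]; exact L1.norm_coord_le z i

@[simp] theorem L1.evalCLM_apply (i : I) (z : L1 I) : L1.evalCLM i z = L1.coord z i := rfl

theorem hasSum_mul_of_nonneg {J : Type*} {f : I → ℝ} {g : J → ℝ} {a b : ℝ} (hf0 : ∀ i, 0 ≤ f i)
    (hg0 : ∀ j, 0 ≤ g j) (hf : HasSum f a) (hg : HasSum g b) :
    HasSum (fun p : I × J => f p.1 * g p.2) (a * b) :=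
  hf.mul hg (Summable.mul_of_nonneg hf.summable hg.summable hf0 hg0)

theorem hasSum_prod_of_nonneg {l : ℕ} {f : Fin l → I → ℝ} {a : Fin l → ℝ} (h0 : ∀ i k, 0 ≤ f i k)
    (h : ∀ i, HasSum (f i) (a i)) :
    HasSum (fun j : Fin l → I => ∏ i, f i (j i)) (∏ i, a i) := by
  induction l with
  | zero =>
    simp only [Finset.univ_eq_empty, Finset.prod_empty]
    exact hasSum_unique (fun _ : Fin 0 → I => (1 : ℝ))
  | succ l ih =>
    have h1 := ih (f := fun i => f i.succ) (a := fun i => a i.succ) (fun i => h0 i.succ)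
      (fun i => h i.succ)
    have h2 := hasSum_mul_of_nonneg (h0 0)
      (fun j => Finset.prod_nonneg fun i _ => h0 (Fin.succ i) (j i)) (h 0) h1
    rw [Fin.prod_univ_succ, ← (Fin.consEquiv (fun _ : Fin (l + 1) => I)).hasSum_iff]
    convert h2 using 1
    funext p
    simp [Fin.prod_univ_succ, Fin.consEquiv]

theorem L1.hasSum_prod_norm {l : ℕ} (z : Fin l → L1 I) :
    HasSum (fun j : Fin l → I => ∏ i, ‖L1.coord (z i) (j i)‖) (∏ i, ‖z i‖) :=
  hasSum_prod_of_nonneg (f := fun i k => ‖L1.coord (z i) k‖) (a := fun i => ‖z i‖)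
    (fun _ _ => norm_nonneg _) fun i => by
      rw [L1.norm_eq]; exact (L1.summable_norm (z i)).hasSum

variable {F : Type*} [NormedAddCommGroup F] [NormedSpace ℂ F] [CompleteSpace F]

theorem L1.summable_kernel {l : ℕ} {T : (Fin l → I) → F} {C : ℝ} (hT : ∀ j, ‖T j‖ ≤ C)
    (z : Fin l → L1 I) : Summable fun j => ‖(∏ i, L1.coord (z i) (j i)) • T j‖ := by
  refine ((L1.hasSum_prod_norm z).summable.mul_right C).of_nonneg_of_le (fun _ => norm_nonneg _)
    fun j => ?_
  rw [norm_smul, norm_prod]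
  exact mul_le_mul_of_nonneg_left (hT j) (Finset.prod_nonneg fun _ _ => norm_nonneg _)

/-- The product of coordinates, as a multilinear map. -/
noncomputable def L1.coordProd {l : ℕ} (j : Fin l → I) : MultilinearMap ℂ (fun _ : Fin l => L1 I) ℂ :=
  (MultilinearMap.mkPiAlgebra ℂ (Fin l) ℂ).compLinearMap fun i => L1.evalₗ (j i)

/-- The continuous multilinear map with a bounded kernel. -/
noncomputable def L1.kernelMap {l : ℕ} (T : (Fin l → I) → F) (C : ℝ) (hT : ∀ j, ‖T j‖ ≤ C) :
    ContinuousMultilinearMap ℂ (fun _ : Fin l => L1 I) F :=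
  MultilinearMap.mkContinuous
    { toFun := fun z => ∑' j, L1.coordProd j z • T j
      map_update_add' := by
        intro _ z i x y
        simp only [MultilinearMap.map_update_add, add_smul]
        exact Summable.tsum_add (L1.summable_kernel hT _).of_norm (L1.summable_kernel hT _).of_norm
      map_update_smul' := by
        intro _ z i c x
        simp only [MultilinearMap.map_update_smul, smul_assoc]
        exact (L1.summable_kernel hT _).of_norm.tsum_const_smul c }
    C fun z => by
      have h := L1.hasSum_prod_norm z
      refine (norm_tsum_le_tsum_norm (L1.summable_kernel hT z)).trans ?_
      rw [← h.tsum_eq, ← tsum_mul_left]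
      refine (L1.summable_kernel hT z).tsum_le_tsum (fun j => ?_) (h.summable.mul_left C)
      rw [norm_smul, norm_prod, mul_comm]
      exact mul_le_mul_of_nonneg_right (hT j) (Finset.prod_nonneg fun _ _ => norm_nonneg _)

theorem L1.kernelMap_apply {l : ℕ} (T : (Fin l → I) → F) (C : ℝ) (hT : ∀ j, ‖T j‖ ≤ C)
    (z : Fin l → L1 I) : L1.kernelMap T C hT z = ∑' j, (∏ i, L1.coord (z i) (j i)) • T j := rfl

theorem L1.norm_kernelMap_le {l : ℕ} (T : (Fin l → I) → F) {C : ℝ} (hC : 0 ≤ C)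
    (hT : ∀ j, ‖T j‖ ≤ C) (z : L1 I) : ‖L1.kernelMap T C hT fun _ => z‖ ≤ C * ‖z‖ ^ l := by
  refine ((L1.kernelMap T C hT).le_of_opNorm_le (MultilinearMap.mkContinuous_norm_le _ hC _) _).trans ?_
  simp

theorem L1.contDiff_kernelMap_diag {l : ℕ} (T : (Fin l → I) → F) {C : ℝ} (hT : ∀ j, ‖T j‖ ≤ C) :
    ContDiff ℂ (⊤ : ℕ∞) fun z : L1 I => L1.kernelMap T C hT fun _ => z :=
  (L1.kernelMap T C hT).contDiff.comp (contDiff_pi.2 fun _ => contDiff_id)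

theorem L1.hasFDerivAt_kernelMap_diag {l : ℕ} (T : (Fin l → I) → F) {C : ℝ} (hT : ∀ j, ‖T j‖ ≤ C)
    (z : L1 I) : HasFDerivAt (fun z : L1 I => L1.kernelMap T C hT fun _ => z)
      (∑ i, ((L1.kernelMap T C hT).toContinuousLinearMap (fun _ => z) i)) z := by
  have h := ((L1.kernelMap T C hT).hasFDerivAt (fun _ => z)).comp (f := fun y : L1 I =>
    fun _ : Fin l => y) z (hasFDerivAt_pi.2 fun _ => hasFDerivAt_id z)
  refine h.congr_fderiv (ContinuousLinearMap.ext fun v => ?_)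
  simp [ContinuousMultilinearMap.linearDeriv_apply]

/-- Fubini isolates the variable in slot `i`. This puts each partial derivative of a polynomial in
the form from which its field can be read off. -/
theorem L1.kernelMap_update {l : ℕ} (a : (Fin (l + 1) → I) → ℂ) {C : ℝ} (ha : ∀ j, ‖a j‖ ≤ C)
    (z v : L1 I) (i : Fin (l + 1)) :
    L1.kernelMap a C ha (Function.update (fun _ => z) i v)
      = ∑' j : Fin l → I, (∏ m, L1.coord z (j m)) • ∑' k, L1.coord v k * a (i.insertNth k j) := by
  have hs := (L1.summable_kernel ha (Function.update (fun _ => z) i v)).of_norm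
  have hp : ∀ p : I × (Fin l → I),
      (∏ m, L1.coord ((Function.update (fun _ => z) i v : Fin (l + 1) → L1 I) m)
        ((Fin.insertNthEquiv (fun _ => I) i p) m)) • a (Fin.insertNthEquiv (fun _ => I) i p)
      = (∏ m, L1.coord z (p.2 m)) • (L1.coord v p.1 * a (i.insertNth p.1 p.2)) := by
    intro p
    rw [Fin.prod_univ_succAbove _ i]
    simp [Fin.insertNthEquiv]
    ring
  rw [L1.kernelMap_apply, ← (Fin.insertNthEquiv (fun _ => I) i).tsum_eq]
  rw [← (Fin.insertNthEquiv (fun _ => I) i).summable_iff] at hs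
  have hs' : Summable fun p : I × (Fin l → I) =>
      (∏ m, L1.coord z (p.2 m)) • (L1.coord v p.1 * a (i.insertNth p.1 p.2)) :=
    hs.congr fun p => hp p
  rw [tsum_congr hp, ← (Equiv.prodComm (Fin l → I) I).tsum_eq fun p : I × (Fin l → I) =>
    (∏ m, L1.coord z (p.2 m)) • (L1.coord v p.1 * a (i.insertNth p.1 p.2))]
  rw [← (Equiv.prodComm (Fin l → I) I).summable_iff] at hs'
  refine (Summable.tsum_prod hs').trans ?_
  refine tsum_congr fun j => ?_
  simp [tsum_mul_left]

end AbsolutelySummable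

namespace L1

variable {I : Type*}

@[simp] theorem coord_zero (i : I) : L1.coord (0 : L1 I) i = 0 := rfl

theorem summable_of_bounded_mul {z : L1 I} {f : I → ℂ} {c : ℝ}
    (h : ∀ i, ‖f i‖ ≤ c * ‖L1.coord z i‖) : Summable fun i => ‖f i‖ :=
  ((L1.summable_norm z).mul_left c).of_nonneg_of_le (fun _ => norm_nonneg _) h

theorem tsum_norm_le_of_bounded_mul {z : L1 I} {f : I → ℂ} {c : ℝ}
    (h : ∀ i, ‖f i‖ ≤ c * ‖L1.coord z i‖) : ∑' i, ‖f i‖ ≤ c * ‖z‖ := by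
  rw [L1.norm_eq, ← tsum_mul_left]
  exact (summable_of_bounded_mul h).tsum_le_tsum h ((L1.summable_norm z).mul_left c)

/-- The family supported at one index. -/
noncomputable def basis (j : I) : L1 I := by
  classical
  exact L1.mk (fun i => if i = j then 1 else 0)
    (summable_of_ne_finset_zero (s := {j}) fun i hi => by
      rw [if_neg (by simpa using hi), norm_zero])

open Classical in
theorem coord_basis (j i : I) : L1.coord (basis j) i = if i = j then 1 else 0 := by
  rw [basis, L1.coord_mk]

/-- The diagonal operator with bounded entries. -/
noncomputable def diag (μ : I → ℂ) (c : ℝ) (h : ∀ i, ‖μ i‖ ≤ c) : L1 I →L[ℂ] L1 I :=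
  have hb : ∀ (z : L1 I) i, ‖μ i * L1.coord z i‖ ≤ c * ‖L1.coord z i‖ := fun z i => by
    rw [norm_mul]; exact mul_le_mul_of_nonneg_right (h i) (norm_nonneg _)
  LinearMap.mkContinuous
    { toFun := fun z => L1.mk (fun i => μ i * L1.coord z i) (summable_of_bounded_mul (hb z))
      map_add' := fun z w => by ext i; simp [mul_add]
      map_smul' := fun r z => by ext i; simp [mul_left_comm] }
    c fun z => by
      rw [L1.norm_eq]
      exact tsum_norm_le_of_bounded_mul (hb z)

@[simp] theorem coord_diag (μ : I → ℂ) (c : ℝ) (h : ∀ i, ‖μ i‖ ≤ c) (z : L1 I) (i : I) :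
    L1.coord (diag μ c h z) i = μ i * L1.coord z i := rfl

theorem norm_diag_le (μ : I → ℂ) (c : ℝ) (h : ∀ i, ‖μ i‖ ≤ c) (z : L1 I) :
    ‖diag μ c h z‖ ≤ c * ‖z‖ := by
  rw [L1.norm_eq]
  exact tsum_norm_le_of_bounded_mul (z := z) fun i => by
    rw [coord_diag, norm_mul]; exact mul_le_mul_of_nonneg_right (h i) (norm_nonneg _)

theorem coord_diag_pow (μ : I → ℂ) (c : ℝ) (h : ∀ i, ‖μ i‖ ≤ c) (z : L1 I) (i : I) (n : ℕ) :
    L1.coord ((diag μ c h ^ n) z) i = μ i ^ n * L1.coord z i := by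
  induction n with
  | zero => simp
  | succ n ih => rw [pow_succ', mul_apply_eq_comp, coord_diag, ih]; ring

theorem coord_exp_diag (μ : I → ℂ) (c : ℝ) (h : ∀ i, ‖μ i‖ ≤ c) (t : ℂ) (z : L1 I) (i : I) :
    L1.coord (NormedSpace.exp (t • diag μ c h) z) i = Complex.exp (t * μ i) * L1.coord z i := by
  have h1 := NormedSpace.exp_series_hasSum_exp' (𝕂 := ℂ) (t • diag μ c h)
  have h2 := ((L1.evalCLM i).comp (ContinuousLinearMap.apply ℂ (L1 I) z)).hasSum h1
  have h3 := (NormedSpace.exp_series_hasSum_exp' (𝕂 := ℂ) (t * μ i)).mul_right (L1.coord z i)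
  rw [← Complex.exp_eq_exp_ℂ] at h3
  refine h2.unique (h3.congr_fun fun n => ?_)
  simp only [ContinuousLinearMap.comp_apply, ContinuousLinearMap.apply_apply,
    smul_pow, smul_apply, L1.evalCLM_apply, L1.coord_smul, coord_diag_pow]
  rw [mul_pow, smul_eq_mul]
  ring

/-- The flow of a diagonal operator. -/
theorem exists_diag_flow (μ : I → ℂ) (c : ℝ) (h : ∀ i, ‖μ i‖ ≤ c) (hre : ∀ i, (μ i).re = 0)
    (z : L1 I) : ∃ ψ : ℝ → L1 I, ψ 0 = z ∧
      (∀ t, HasDerivAt ψ (diag μ c h (ψ t)) t) ∧ (∀ t, ‖ψ t‖ = ‖z‖) ∧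
      ∀ i, L1.coord (ψ 1) i = Complex.exp (μ i) * L1.coord z i := by
  refine ⟨fun t => NormedSpace.exp ((t : ℂ) • diag μ c h) z, ?_, fun t => ?_, fun t => ?_,
    fun i => ?_⟩
  · ext i; rw [coord_exp_diag]; simp
  · have h1 := (hasDerivAt_exp_smul_const' (𝕂 := ℂ) (diag μ c h) (t : ℂ)).scomp t
      (Complex.ofRealCLM.hasDerivAt (x := t))
    have h2 := ((ContinuousLinearMap.apply ℂ (L1 I) z).restrictScalars ℝ).hasFDerivAt.comp_hasDerivAt
      t h1
    simpa [Function.comp_def] using h2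
  · rw [L1.norm_eq, L1.norm_eq]
    refine tsum_congr fun i => ?_
    rw [coord_exp_diag, norm_mul, Complex.norm_exp]
    simp [hre i]
  · rw [coord_exp_diag]; simp

end L1

/-! ### The symplectic structure on `ℓ¹` and quadratic Hamiltonians. -/

namespace Splitting

variable {d : ℕ} {N : Set (Fin d → ℤ)}

theorem Idx.bar_bar (j : Idx N) : j.bar.bar = j := by simp [Idx.bar]

/-- Conjugation of indices, as an equivalence. -/
def Idx.barEquiv : Idx N ≃ Idx N where
  toFun := Idx.bar
  invFun := Idx.bar
  left_inv := Idx.bar_bar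
  right_inv := Idx.bar_bar

/-- The sign of an index. -/
def Idx.sign (j : Idx N) : ℂ := ((j.2 : ℤ) : ℂ)

theorem Idx.sign_bar (j : Idx N) : j.bar.sign = -j.sign := by simp [Idx.sign, Idx.bar]

theorem Idx.sign_mul_self (j : Idx N) : j.sign * j.sign = 1 := by
  rcases Int.units_eq_one_or j.2 with h | h <;> simp [Idx.sign, h]

theorem Idx.norm_sign (j : Idx N) : ‖j.sign‖ = 1 := by
  rcases Int.units_eq_one_or j.2 with h | h <;> simp [Idx.sign, h]

theorem norm_pairing_le (u v : L1 (Idx N)) (j : Idx N) :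
    ‖j.sign * (L1.coord u j * L1.coord v j.bar)‖ ≤ ‖v‖ * ‖L1.coord u j‖ := by
  rw [norm_mul, Idx.norm_sign, one_mul, norm_mul, mul_comm]
  exact mul_le_mul_of_nonneg_right (L1.norm_coord_le v _) (norm_nonneg _)

theorem summable_pairing (u v : L1 (Idx N)) :
    Summable fun j : Idx N => j.sign * (L1.coord u j * L1.coord v j.bar) :=
  (L1.summable_of_bounded_mul (norm_pairing_le u v)).of_norm

/-- The symplectic form for which the Hamiltonian system of `F` is
`ξ' = -i ∂F/∂η`, `η' = i ∂F/∂ξ`. -/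
noncomputable def symplecticForm (N : Set (Fin d → ℤ)) : SymplecticForm (L1 (Idx N)) where
  form := LinearMap.mkContinuous₂
    (LinearMap.mk₂ ℂ (fun u v => Complex.I * ∑' j : Idx N, j.sign * (L1.coord u j * L1.coord v j.bar))
      (fun u u' v => by
        rw [← mul_add, ← (summable_pairing u v).tsum_add (summable_pairing u' v)]
        simp only [L1.coord_add, add_mul, mul_add])
      (fun c u v => by
        simp only [L1.coord_smul, smul_eq_mul]
        rw [mul_left_comm, ← tsum_mul_left (a := c)]
        congr 1
        exact tsum_congr fun j => by ring)
      (fun u v v' => by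
        rw [← mul_add, ← (summable_pairing u v).tsum_add (summable_pairing u v')]
        simp only [L1.coord_add, mul_add])
      (fun c u v => by
        simp only [L1.coord_smul, smul_eq_mul]
        rw [mul_left_comm, ← tsum_mul_left (a := c)]
        congr 1
        exact tsum_congr fun j => by ring)) 1
    (fun u v => by
      rw [LinearMap.mk₂_apply, norm_mul, Complex.norm_I, one_mul, one_mul, mul_comm]
      exact (norm_tsum_le_tsum_norm (summable_pairing u v).norm).trans
        (L1.tsum_norm_le_of_bounded_mul (norm_pairing_le u v)))
  antisymm u v := by
    simp only [LinearMap.mkContinuous₂_apply, LinearMap.mk₂_apply]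
    rw [← mul_neg, ← tsum_neg, ← Idx.barEquiv.tsum_eq]
    congr 1
    refine tsum_congr fun j => ?_
    simp only [Idx.barEquiv, Equiv.coe_fn_mk, Idx.sign_bar, Idx.bar_bar]
    ring
  nondegenerate u h := by
    ext j
    have hj := h (L1.basis j.bar)
    simp only [LinearMap.mkContinuous₂_apply, LinearMap.mk₂_apply] at hj
    rw [tsum_eq_single j] at hj
    · have hs : j.sign ≠ 0 := fun h0 => by simpa [h0] using j.sign_mul_self
      simpa [L1.coord_basis, hs] using hj
    · intro i hi
      have : i.bar ≠ j.bar := fun hh => hi (Idx.barEquiv.injective hh)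
      simp [L1.coord_basis, this]
  norm_le u v := by
    simp only [LinearMap.mkContinuous₂_apply, LinearMap.mk₂_apply]
    rw [norm_mul, Complex.norm_I, one_mul, mul_comm]
    exact (norm_tsum_le_tsum_norm (summable_pairing u v).norm).trans
      (L1.tsum_norm_le_of_bounded_mul (norm_pairing_le u v))

theorem symplecticForm_apply (u v : L1 (Idx N)) : (symplecticForm N).form u v
    = Complex.I * ∑' j : Idx N, j.sign * (L1.coord u j * L1.coord v j.bar) := rfl

theorem symplecticForm_basis (u : L1 (Idx N)) (j : Idx N) :
    (symplecticForm N).form u (L1.basis j.bar) = Complex.I * (j.sign * L1.coord u j) := by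
  rw [symplecticForm_apply, tsum_eq_single j]
  · simp [L1.coord_basis]
  · intro i hi
    have : i.bar ≠ j.bar := fun hh => hi (Idx.barEquiv.injective hh)
    simp [L1.coord_basis, this]

/-- The vector field of a Hamiltonian function is the one given by partial derivatives. -/
theorem vectorField_eq_field (F : HamFun (symplecticForm N)) {f : (Idx N → ℂ) → ℂ}
    (hf : ∀ z : L1 (Idx N), f (L1.coord z) = F.val z) (z : L1 (Idx N)) :
    vectorField f (L1.coord z) = L1.coord (F.field z) := by
  funext j
  have hup : ∀ w : ℂ, Function.update (L1.coord z) j.bar w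
      = L1.coord (z + (w - L1.coord z j.bar) • L1.basis j.bar) := by
    intro w
    funext i
    rw [Function.update_apply, L1.coord_add, L1.coord_smul, L1.coord_basis]
    by_cases h : i = j.bar <;> simp [h]
  have hline : HasDerivAt (fun w : ℂ => z + (w - L1.coord z j.bar) • L1.basis j.bar)
      (L1.basis j.bar) (L1.coord z j.bar) := by
    simpa using (((hasDerivAt_id (L1.coord z j.bar)).sub_const (L1.coord z j.bar)).smul_const
      (L1.basis j.bar)).const_add z
  have hF : HasFDerivAt F.val ((symplecticForm N).form (F.field z))
      (z + (L1.coord z j.bar - L1.coord z j.bar) • L1.basis j.bar) := by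
    simpa using F.hasFDerivAt z
  have hd := (hF.comp_hasDerivAt _ hline).deriv
  rw [symplecticForm_basis] at hd
  have hp : partialDeriv f (L1.coord z) j.bar = Complex.I * (j.sign * L1.coord (F.field z) j) := by
    rw [← hd, partialDeriv]
    congr 1
    funext w
    rw [hup, hf]
    rfl
  rw [vectorField, hp]
  change -Complex.I * j.sign * (Complex.I * (j.sign * L1.coord (F.field z) j)) = _
  linear_combination (-(Complex.I * Complex.I) * L1.coord (F.field z) j) * j.sign_mul_self
    - L1.coord (F.field z) j * Complex.I_mul_I

/-- The quadratic Hamiltonian `∑ λ_a ξ_a η_a` with bounded `λ`. -/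
theorem exists_quadratic_hamFun (lam : N → ℝ) (c : ℝ) (hc : ∀ a, |lam a| ≤ c) :
    ∃ (A : HamFun (symplecticForm N)) (hμ : ∀ j : Idx N, ‖-Complex.I * j.sign * (lam j.1 : ℂ)‖ ≤ c),
      (∀ z, A.field z = L1.diag (fun j : Idx N => -Complex.I * j.sign * (lam j.1 : ℂ)) c hμ z) ∧
      ∀ z, A.val z = ∑' a : N, (lam a : ℂ) * (L1.coord z (a, 1) * L1.coord z (a, -1)) := by
  have hμ : ∀ j : Idx N, ‖-Complex.I * j.sign * (lam j.1 : ℂ)‖ ≤ c := fun j => by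
    rw [norm_mul, norm_mul, norm_neg, Complex.norm_I, Idx.norm_sign, one_mul, one_mul,
      Complex.norm_real]
    exact hc _
  set D := L1.diag (fun j : Idx N => -Complex.I * j.sign * (lam j.1 : ℂ)) c hμ with hD
  set Ω := (symplecticForm N).form with hΩ
  -- Symmetry of this bilinear form makes `Ω (D z)` the derivative of `½ Ω (D z) z`.
  have hsymm : ∀ u v, Ω (D v) u = Ω (D u) v := by
    intro u v
    rw [hΩ, (symplecticForm N).antisymm (D v) u, symplecticForm_apply, symplecticForm_apply,
      ← mul_neg, ← tsum_neg]
    congr 1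
    refine tsum_congr fun j => ?_
    simp only [hD, L1.coord_diag, Idx.sign_bar]
    have : j.bar.1 = j.1 := rfl
    rw [this]; ring
  refine ⟨⟨(fun z => (2 : ℂ)⁻¹ * Ω (D z) z, fun z => D z), by simp, by simp, D.contDiff, fun z => ?_,
    fun r => ⟨|c| * |r|, fun z hz => ?_⟩⟩, hμ, fun z => rfl, fun z => ?_⟩
  · have h := (((Ω.comp D).hasFDerivAt (x := z)).clm_apply (hasFDerivAt_id z)).const_mul (2 : ℂ)⁻¹
    refine h.congr_fderiv (ContinuousLinearMap.ext fun v => ?_)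
    simp only [smul_apply, add_apply, ContinuousLinearMap.comp_apply,
      ContinuousLinearMap.flip_apply, id, ContinuousLinearMap.id_apply, smul_eq_mul]
    rw [hsymm z v]
    ring
  · refine (L1.norm_diag_le _ c hμ z).trans (mul_le_mul (le_abs_self c)
      (hz.trans (le_abs_self r)) (norm_nonneg _) (abs_nonneg _))
  · change (2 : ℂ)⁻¹ * Ω (D z) z = _
    rw [hΩ, symplecticForm_apply]
    have hterm : ∀ j : Idx N, j.sign * (L1.coord (D z) j * L1.coord z j.bar)
        = -Complex.I * ((lam j.1 : ℂ) * (L1.coord z (j.1, 1) * L1.coord z (j.1, -1))) := by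
      rintro ⟨a, e⟩
      simp only [hD, L1.coord_diag]
      rcases Int.units_eq_one_or e with rfl | rfl
      · simp [Idx.sign, Idx.bar]; ring
      · simp [Idx.sign, Idx.bar]; ring
    have hs := summable_pairing (D z) z
    rw [Summable.tsum_prod hs]
    have hin : ∀ a : N, ∑' e : ℤˣ, Idx.sign ((a, e) : Idx N) *
        (L1.coord (D z) (a, e) * L1.coord z (Idx.bar (a, e)))
        = (2 * -Complex.I) * ((lam a : ℂ) * (L1.coord z (a, 1) * L1.coord z (a, -1))) := by
      intro a
      rw [tsum_congr fun e => hterm (a, e), tsum_fintype]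
      simp
      ring
    rw [tsum_congr hin, tsum_mul_left]
    linear_combination (-(∑' a : N, (lam a : ℂ) * (L1.coord z (a, 1) * L1.coord z (a, -1)))) *
      Complex.I_mul_I

end Splitting

/-! ### Polynomial Hamiltonians of zero momentum. -/

namespace Splitting

variable {d : ℕ} {N : Set (Fin d → ℤ)}

/-- A bounded family on whose support the sign is injective has at most two nonzero terms. -/
theorem summable_and_tsum_norm_le_of_injOn {f : Idx N → ℂ} {C : ℝ} (hC : 0 ≤ C)
    (hf : ∀ k, ‖f k‖ ≤ C)
    (hinj : Set.InjOn Prod.snd {k | f k ≠ 0}) :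
    Summable (fun k => ‖f k‖) ∧ ∑' k, ‖f k‖ ≤ 2 * C := by
  have hfin : {k | f k ≠ 0}.Finite := Set.Finite.of_injOn (Set.mapsTo_univ _ _) hinj Set.finite_univ
  have h0 : ∀ k ∉ hfin.toFinset, ‖f k‖ = 0 := fun k hk => by simpa using hk
  refine ⟨summable_of_ne_finset_zero h0, ?_⟩
  rw [tsum_eq_sum h0]
  have hcard : hfin.toFinset.card ≤ 2 := by
    have := Finset.card_le_card_of_injOn (s := hfin.toFinset) (t := (Finset.univ : Finset ℤˣ))
      Prod.snd (fun _ _ => Finset.mem_univ _) (by simpa using hinj)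
    simpa using this
  refine (Finset.sum_le_card_nsmul _ _ C fun k _ => hf k).trans ?_
  rw [nsmul_eq_mul]
  exact mul_le_mul_of_nonneg_right (by exact_mod_cast hcard) hC

theorem momentum_insertNth {l : ℕ} (i : Fin (l + 1)) (k : Idx N) (j : Fin l → Idx N) :
    momentum (i.insertNth (α := fun _ => Idx N) k j)
      = ((k.2 : ℤ)) • (k.1 : Fin d → ℤ) + momentum j := by
  rw [momentum, Fin.sum_univ_succAbove _ i]
  simp [momentum]

section Homogeneous

variable {l : ℕ} {a : (Fin (l + 1) → Idx N) → ℂ} {C : ℝ}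

/-- The coefficients of the vector field coming from the `i`-th factor of each monomial. -/
def fieldCoeff (a : (Fin (l + 1) → Idx N) → ℂ) (i : Fin (l + 1)) (j : Fin l → Idx N) (k : Idx N) :
    ℂ :=
  -Complex.I * k.sign * a (i.insertNth (α := fun _ => Idx N) k.bar j)

/-- Once the other indices and the sign are given, zero momentum determines the remaining mode. At
most two entries survive, one per sign, so bounded coefficients give a bounded `ℓ¹`-valued kernel.
-/
theorem fieldCoeff_bound (hC : 0 ≤ C) (ha : ∀ j, ‖a j‖ ≤ C) (hmom : ∀ j, momentum j ≠ 0 → a j = 0)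
    (i : Fin (l + 1)) (j : Fin l → Idx N) :
    Summable (fun k => ‖fieldCoeff a i j k‖) ∧ ∑' k, ‖fieldCoeff a i j k‖ ≤ 2 * C := by
  refine summable_and_tsum_norm_le_of_injOn hC (fun k => ?_) ?_
  · rw [fieldCoeff, norm_mul, norm_mul, norm_neg, Complex.norm_I, Idx.norm_sign, one_mul, one_mul]
    exact ha _
  · rintro ⟨b, e⟩ hk ⟨b', e'⟩ hk' (he : e = e')
    subst he
    have key : ∀ k : Idx N, fieldCoeff a i j k ≠ 0 →
        ((k.bar.2 : ℤ)) • (k.bar.1 : Fin d → ℤ) + momentum j = 0 := by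
      intro k hk
      rw [← momentum_insertNth i]
      by_contra hne
      exact hk (by rw [fieldCoeff, hmom _ hne, mul_zero])
    have h1 := key _ hk
    have h2 := key _ hk'
    have h3 := add_right_cancel (h1.trans h2.symm)
    have hb : (b : Fin d → ℤ) = b' := by
      rcases Int.units_eq_one_or e with rfl | rfl <;> simpa [Idx.bar] using h3
    exact Prod.ext (Subtype.ext hb) rfl

/-- The coefficients of the vector field, as absolutely summable families. -/
noncomputable def fieldKernel (hC : 0 ≤ C) (ha : ∀ j, ‖a j‖ ≤ C) (hmom : ∀ j, momentum j ≠ 0 → a j = 0)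
    (i : Fin (l + 1)) (j : Fin l → Idx N) : L1 (Idx N) :=
  L1.mk (fieldCoeff a i j) (fieldCoeff_bound hC ha hmom i j).1

theorem norm_fieldKernel_le (hC : 0 ≤ C) (ha : ∀ j, ‖a j‖ ≤ C) (hmom : ∀ j, momentum j ≠ 0 → a j = 0)
    (i : Fin (l + 1)) (j : Fin l → Idx N) : ‖fieldKernel hC ha hmom i j‖ ≤ 2 * C := by
  rw [L1.norm_eq]
  exact (fieldCoeff_bound hC ha hmom i j).2

theorem form_fieldKernel (hC : 0 ≤ C) (ha : ∀ j, ‖a j‖ ≤ C) (hmom : ∀ j, momentum j ≠ 0 → a j = 0)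
    (i : Fin (l + 1)) (j : Fin l → Idx N) (v : L1 (Idx N)) :
    (symplecticForm N).form (fieldKernel hC ha hmom i j) v
      = ∑' k, L1.coord v k * a (i.insertNth (α := fun _ => Idx N) k j) := by
  rw [symplecticForm_apply, ← tsum_mul_left, ← Idx.barEquiv.tsum_eq (fun k => L1.coord v k * _)]
  refine tsum_congr fun k => ?_
  change Complex.I * (k.sign * (-Complex.I * k.sign * a (i.insertNth k.bar j) *
    L1.coord v k.bar)) = L1.coord v k.bar * a (i.insertNth k.bar j)
  linear_combination (-(Complex.I * Complex.I) * (L1.coord v k.bar * a (i.insertNth k.bar j))) *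
    k.sign_mul_self - L1.coord v k.bar * a (i.insertNth k.bar j) * Complex.I_mul_I

/-- A homogeneous polynomial with bounded coefficients and zero momentum is a Hamiltonian
function. -/
theorem exists_homogeneous_hamFun (hl : 1 ≤ l) (hC : 0 ≤ C) (ha : ∀ j, ‖a j‖ ≤ C)
    (hmom : ∀ j, momentum j ≠ 0 → a j = 0) :
    ∃ F : HamFun (symplecticForm N),
      (∀ z, F.val z = ∑' j, a j * ∏ i, L1.coord z (j i)) ∧
      ∀ z, ‖F.field z‖ ≤ (l + 1) * (2 * C * ‖z‖ ^ l) := by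
  set G : Fin (l + 1) → L1 (Idx N) → L1 (Idx N) := fun i z =>
    L1.kernelMap (fieldKernel hC ha hmom i) (2 * C) (norm_fieldKernel_le hC ha hmom i) fun _ => z with hG
  have hGn : ∀ i z, ‖G i z‖ ≤ 2 * C * ‖z‖ ^ l := fun i z =>
    L1.norm_kernelMap_le _ (by positivity) _ z
  have hbd : ∀ z, ‖∑ i, G i z‖ ≤ (l + 1) * (2 * C * ‖z‖ ^ l) := fun z => by
    refine (norm_sum_le _ _).trans ((Finset.sum_le_card_nsmul _ _ _ fun i _ => hGn i z).trans_eq ?_)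
    simp
  have hval0 : L1.kernelMap a C ha (fun _ => (0 : L1 (Idx N))) = 0 :=
    (L1.kernelMap a C ha).map_coord_zero 0 rfl
  have hder : ∀ z v i, L1.kernelMap a C ha (Function.update (fun _ => z) i v)
      = (symplecticForm N).form (G i z) v := by
    intro z v i
    rw [L1.kernelMap_update]
    have hs := (L1.summable_kernel (norm_fieldKernel_le hC ha hmom i) (fun _ : Fin l => z)).of_norm
    have h1 := ((symplecticForm N).form.flip v).map_tsum hs
    simp only [ContinuousLinearMap.flip_apply, map_smul] at h1
    rw [hG]
    simp only
    rw [L1.kernelMap_apply, h1]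
    refine tsum_congr fun j => ?_
    rw [form_fieldKernel]
  refine ⟨⟨(fun z => L1.kernelMap a C ha fun _ => z, fun z => ∑ i, G i z), hval0, ?_, ?_,
    fun z => ?_, fun r => ⟨(l + 1) * (2 * C * |r| ^ l), fun z hz => ?_⟩⟩, fun z => ?_, hbd⟩
  · have h := hbd 0
    rw [norm_zero, zero_pow (by omega), mul_zero, mul_zero] at h
    exact norm_le_zero_iff.1 h
  · have hsum : ContDiff ℂ (⊤ : ℕ∞) fun z => ∑ i, G i z :=
      ContDiff.sum fun i _ => L1.contDiff_kernelMap_diag _ (norm_fieldKernel_le hC ha hmom i)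
    exact hsum
  · refine (L1.hasFDerivAt_kernelMap_diag a ha z).congr_fderiv (ContinuousLinearMap.ext fun v => ?_)
    simp only [map_sum, sum_apply]
    exact Finset.sum_congr rfl fun i _ => hder z v i
  · refine (hbd z).trans ?_
    have : ‖z‖ ≤ |r| := hz.trans (le_abs_self r)
    gcongr
  · change L1.kernelMap a C ha (fun _ => z) = _
    rw [L1.kernelMap_apply]
    exact tsum_congr fun j => by rw [smul_eq_mul, mul_comm]

end Homogeneous

/-- In degree `l` there are `l` slots to differentiate and two signs, giving `2 l ‖z‖ ^ (l - 1)`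
times the supremum of the coefficients; `l ≤ k` and `1 ≤ r` make this uniform. -/
theorem exists_polyHam_hamFun {k : ℕ} (P : PolyHam N k) :
    ∃ F : HamFun (symplecticForm N), (∀ z : L1 (Idx N), F.val z = P.eval (L1.coord z)) ∧
      ∀ r : ℝ, 1 ≤ r → ∀ z, ‖z‖ ≤ r → ‖F.field z‖ ≤ 2 * k * r ^ k * P.norm := by
  have hbdd : ∀ l, BddAbove (Set.range fun j : Fin l → Idx N => ‖P.coeff l j‖) := by
    obtain ⟨C, hC⟩ := P.bounded
    rintro l
    refine ⟨C, ?_⟩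
    rintro _ ⟨j, rfl⟩
    exact hC l j
  have hex : ∀ l ∈ Finset.Icc 2 k, ∃ F : HamFun (symplecticForm N),
      (∀ z, F.val z = ∑' j : Fin l → Idx N, P.coeff l j * ∏ i, L1.coord z (j i)) ∧
      ∀ z, ‖F.field z‖ ≤ l * (2 * (⨆ j : Fin l → Idx N, ‖P.coeff l j‖) * ‖z‖ ^ (l - 1)) := by
    intro l hl
    obtain ⟨m, rfl⟩ : ∃ m, l = m + 1 := ⟨l - 1, by have := Finset.mem_Icc.1 hl; omega⟩
    obtain ⟨F, h1, h2⟩ := exists_homogeneous_hamFun (l := m) (a := P.coeff (m + 1))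
      (C := ⨆ j : Fin (m + 1) → Idx N, ‖P.coeff (m + 1) j‖)
      (by have := Finset.mem_Icc.1 hl; omega) (Real.iSup_nonneg fun _ => norm_nonneg _)
      (fun j => le_ciSup (hbdd (m + 1)) j) (fun j => P.coeff_eq_zero_of_momentum (m + 1) j)
    exact ⟨F, h1, by simpa using h2⟩
  choose! F hF1 hF2 using hex
  refine ⟨∑ l ∈ Finset.Icc 2 k, F l, fun z => ?_, fun r hr z hz => ?_⟩
  · rw [HamFun.sum_val, PolyHam.eval]
    exact Finset.sum_congr rfl fun l hl => hF1 l hl z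
  · have hfield : (∑ l ∈ Finset.Icc 2 k, F l).field z = ∑ l ∈ Finset.Icc 2 k, (F l).field z :=
      map_sum (⟨⟨fun G => G.field z, rfl⟩, fun _ _ => rfl⟩ :
        HamFun (symplecticForm N) →+ L1 (Idx N)) F _
    rw [hfield, PolyHam.norm, Finset.mul_sum]
    refine (norm_sum_le _ _).trans (Finset.sum_le_sum fun l hl => (hF2 l hl z).trans ?_)
    have hlk := (Finset.mem_Icc.1 hl).2
    have hS : 0 ≤ ⨆ j : Fin l → Idx N, ‖P.coeff l j‖ := Real.iSup_nonneg fun _ => norm_nonneg _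
    have h1 : ‖z‖ ^ (l - 1) ≤ r ^ k :=
      (pow_le_pow_left₀ (norm_nonneg _) hz _).trans (pow_le_pow_right₀ hr (by omega))
    have h2 : (l : ℝ) ≤ k := by exact_mod_cast hlk
    calc _ ≤ (k : ℝ) * (2 * (⨆ j : Fin l → Idx N, ‖P.coeff l j‖) * r ^ k) := by gcongr
      _ = _ := by ring

end Splitting

/-! ### The filter, the weighted ball and the scalar estimates. -/

theorem abs_arctan_le (x : ℝ) : |Real.arctan x| ≤ |x| := by
  have h := (convex_univ (𝕜 := ℝ) (E := ℝ)).norm_image_sub_le_of_norm_hasDerivWithin_le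
    (f := Real.arctan) (f' := fun y => 1 / (1 + y ^ 2)) (C := 1) (x := 0) (y := x)
    (fun y _ => (Real.hasDerivAt_arctan y).hasDerivWithinAt)
    (fun y _ => by
      rw [Real.norm_eq_abs, abs_of_nonneg (by positivity), div_le_one (by positivity)]
      nlinarith [sq_nonneg y]) (Set.mem_univ _) (Set.mem_univ _)
  simpa using h

theorem abs_arctan_sub_self_le (x : ℝ) : |Real.arctan x - x| ≤ |x| ^ 3 := by
  have h := (convex_uIcc (0 : ℝ) x).norm_image_sub_le_of_norm_hasDerivWithin_le
    (f := fun y => Real.arctan y - y) (f' := fun y => 1 / (1 + y ^ 2) - 1) (C := |x| ^ 2)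
    (x := 0) (y := x)
    (fun y _ => ((Real.hasDerivAt_arctan y).sub (hasDerivAt_id y)).hasDerivWithinAt)
    (fun y hy => by
      have hyx : |y| ≤ |x| := by
        have := Set.abs_sub_left_of_mem_uIcc hy
        simpa using this
      have h1 : 1 / (1 + y ^ 2) - 1 = -(y ^ 2 / (1 + y ^ 2)) := by
        have : (1 + y ^ 2) ≠ 0 := by positivity
        field_simp
        ring
      rw [h1, norm_neg, Real.norm_eq_abs, abs_of_nonneg (by positivity)]
      refine (div_le_self (sq_nonneg y) (by nlinarith [sq_nonneg y])).trans ?_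
      rw [← sq_abs y]
      exact pow_le_pow_left₀ (abs_nonneg y) hyx 2) Set.left_mem_uIcc Set.right_mem_uIcc
  simp only [Real.arctan_zero, sub_zero, Real.norm_eq_abs] at h
  exact h.trans_eq (by ring)

theorem summable_and_tsum_le_of_norm_le {ι E : Type*} [NormedAddCommGroup E] (f : ι → E) (g : ι → ℝ)
    (hg : Summable g) (h : ∀ i, ‖f i‖ ≤ g i) :
    Summable (fun i => ‖f i‖) ∧ ∑' i, ‖f i‖ ≤ ∑' i, g i := by
  have hs : Summable fun i => ‖f i‖ := Summable.of_nonneg_of_le (fun _ => norm_nonneg _) h hg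
  exact ⟨hs, hs.tsum_le_tsum h hg⟩

/-- In a product of two coordinates of the same mode, one weighted factor is bounded by `M` and the
other is summed. Actions thus carry the squared weight, which is why `3m ≤ 2s` suffices later. -/
theorem summable_mul_pair {A : Type*} {w : A → ℝ} (hw : ∀ a, 0 ≤ w a) {z : A × ℤˣ → ℂ} {M : ℝ}
    (hz : Summable fun j : A × ℤˣ => w j.1 * ‖z j‖) (hM : ∑' j : A × ℤˣ, w j.1 * ‖z j‖ ≤ M) :
    Summable (fun a => w a * w a * ‖z (a, 1) * z (a, -1)‖) ∧
      ∑' a, w a * w a * ‖z (a, 1) * z (a, -1)‖ ≤ M * M := by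
  have hnn : ∀ j : A × ℤˣ, 0 ≤ w j.1 * ‖z j‖ := fun j => mul_nonneg (hw _) (norm_nonneg _)
  have hinj : Function.Injective fun a : A => ((a, 1) : A × ℤˣ) := fun a b h => congrArg Prod.fst h
  have h1 : Summable fun a : A => w a * ‖z (a, 1)‖ := hz.comp_injective hinj
  have h1' : ∑' a : A, w a * ‖z (a, 1)‖ ≤ M :=
    (tsum_comp_le_tsum_of_inj hz hnn hinj).trans hM
  have hM0 : 0 ≤ M := (tsum_nonneg hnn).trans hM
  have hle : ∀ a, ‖w a * w a * ‖z (a, 1) * z (a, -1)‖‖ ≤ M * (w a * ‖z (a, 1)‖) := fun a => by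
    rw [Real.norm_of_nonneg (mul_nonneg (mul_nonneg (hw a) (hw a)) (norm_nonneg _)), norm_mul]
    calc _ = (w a * ‖z (a, -1)‖) * (w a * ‖z (a, 1)‖) := by ring
      _ ≤ _ := mul_le_mul_of_nonneg_right
          ((hz.le_tsum (a, -1) fun i _ => hnn i).trans hM) (hnn (a, 1))
  have hs : Summable fun a => w a * w a * ‖z (a, 1) * z (a, -1)‖ :=
    Summable.of_norm_bounded (h1.mul_left M) hle
  refine ⟨hs, (hs.tsum_le_tsum (fun a => (le_abs_self _).trans (hle a)) (h1.mul_left M)).trans ?_⟩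
  rw [tsum_mul_left]
  exact mul_le_mul_of_nonneg_left h1' hM0

theorem norm_tsum_mul_sub_le {A : Type*} {lam ω v : A → ℝ} {u : A → ℂ} {h b S : ℝ}
    (hb : 0 ≤ b) (hv : Summable fun a => v a * ‖u a‖) (hS : ∑' a, v a * ‖u a‖ ≤ S)
    (hω : ∀ a, |ω a| ≤ b * v a) (hlam : ∀ a, |lam a| ≤ h * |ω a|)
    (hsub : ∀ a, |lam a - h * ω a| ≤ h ^ 2 * (b ^ 3 * v a)) :
    ‖∑' a, (lam a : ℂ) * u a - h * ∑' a, (ω a : ℂ) * u a‖ ≤ h ^ 2 * (b ^ 3 * S) := by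
  have hs1 : Summable fun a => (ω a : ℂ) * u a := by
    refine Summable.of_norm_bounded (hv.mul_left b) fun a => ?_
    rw [norm_mul, Complex.norm_real, ← mul_assoc]
    exact mul_le_mul_of_nonneg_right (hω a) (norm_nonneg _)
  have hs2 : Summable fun a => (lam a : ℂ) * u a := by
    refine Summable.of_norm_bounded (hs1.norm.mul_left h) fun a => ?_
    rw [norm_mul, norm_mul, Complex.norm_real, Complex.norm_real, ← mul_assoc]
    exact mul_le_mul_of_nonneg_right (hlam a) (norm_nonneg _)
  rw [← tsum_mul_left, ← hs2.tsum_sub (hs1.mul_left _)]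
  have hle : ∀ a, ‖(lam a : ℂ) * u a - h * ((ω a : ℂ) * u a)‖ ≤ h ^ 2 * b ^ 3 * (v a * ‖u a‖) := by
    intro a
    rw [← mul_assoc, ← sub_mul, norm_mul, ← Complex.ofReal_mul, ← Complex.ofReal_sub,
      Complex.norm_real, ← mul_assoc]
    refine mul_le_mul_of_nonneg_right ((hsub a).trans_eq ?_) (norm_nonneg _)
    ring
  refine (tsum_of_norm_bounded (hv.mul_left (h ^ 2 * b ^ 3)).hasSum hle).trans ?_
  rw [tsum_mul_left, mul_assoc]
  exact mul_le_mul_of_nonneg_left (mul_le_mul_of_nonneg_left hS (by positivity)) (by positivity)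

namespace Splitting

variable {d : ℕ} {N : Set (Fin d → ℤ)}

theorem one_le_modeSize (a : N) : 1 ≤ modeSize a :=
  Real.one_le_sqrt.2 (le_max_left _ _)

theorem modeSize_rpow_le {p q : ℝ} (h : p ≤ q) (a : N) : modeSize a ^ p ≤ modeSize a ^ q :=
  Real.rpow_le_rpow_of_exponent_le (one_le_modeSize a) h

theorem one_le_modeSize_rpow {s : ℝ} (hs : 0 ≤ s) (a : N) : 1 ≤ modeSize a ^ s :=
  Real.one_le_rpow (one_le_modeSize a) hs

theorem filterFun_eq {h : ℝ} (hh : 0 < h) (x : ℝ) :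
    filterFun h (h * x) = Real.sqrt h * Real.arctan (Real.sqrt h * x) := by
  have hs : Real.sqrt h ≠ 0 := (Real.sqrt_pos.2 hh).ne'
  rw [filterFun]
  congr 2
  rw [div_eq_iff hs]
  nth_rewrite 1 [← Real.mul_self_sqrt hh.le]
  ring

/-- The purpose of the filter: a bound uniform in the frequencies, with `π / 2 ≤ 2`. -/
theorem abs_filterFun_le_sqrt {h : ℝ} (x : ℝ) : |filterFun h x| ≤ 2 * Real.sqrt h := by
  rw [filterFun, abs_mul, abs_of_nonneg (Real.sqrt_nonneg h), mul_comm]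
  refine mul_le_mul_of_nonneg_right ?_ (Real.sqrt_nonneg h)
  have h1 := Real.arctan_lt_pi_div_two (x / Real.sqrt h)
  have h2 := Real.neg_pi_div_two_lt_arctan (x / Real.sqrt h)
  have h3 := Real.pi_le_four
  rw [abs_le]
  constructor <;> linarith

theorem abs_filterFun_le {h : ℝ} (hh : 0 < h) (x : ℝ) : |filterFun h (h * x)| ≤ h * |x| := by
  rw [filterFun_eq hh, abs_mul, abs_of_nonneg (Real.sqrt_nonneg h)]
  refine (mul_le_mul_of_nonneg_left (abs_arctan_le _) (Real.sqrt_nonneg h)).trans_eq ?_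
  rw [abs_mul, abs_of_nonneg (Real.sqrt_nonneg h), ← mul_assoc, Real.mul_self_sqrt hh.le]

theorem abs_filterFun_sub_le {h : ℝ} (hh : 0 < h) (x : ℝ) :
    |filterFun h (h * x) - h * x| ≤ h ^ 2 * |x| ^ 3 := by
  have hs := Real.mul_self_sqrt hh.le
  have h1 : filterFun h (h * x) - h * x
      = Real.sqrt h * (Real.arctan (Real.sqrt h * x) - Real.sqrt h * x) := by
    rw [filterFun_eq hh]
    linear_combination x * hs
  rw [h1, abs_mul, abs_of_nonneg (Real.sqrt_nonneg h)]
  refine (mul_le_mul_of_nonneg_left (abs_arctan_sub_self_le _) (Real.sqrt_nonneg h)).trans_eq ?_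
  rw [abs_mul, abs_of_nonneg (Real.sqrt_nonneg h)]
  calc _ = (Real.sqrt h * Real.sqrt h) ^ 2 * |x| ^ 3 := by ring
    _ = _ := by rw [hs]

section Ball

variable {s M : ℝ} {z : Idx N → ℂ}

theorem norm_le_weighted (hs : 0 ≤ s) (j : Idx N) : ‖z j‖ ≤ modeSize j.1 ^ s * ‖z j‖ :=
  le_mul_of_one_le_left (norm_nonneg _) (one_le_modeSize_rpow hs _)

theorem summable_norm_of_mem_ball (hs : 0 ≤ s) (hz : z ∈ ball N s M) :
    Summable fun j => ‖z j‖ :=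
  hz.1.of_nonneg_of_le (fun _ => norm_nonneg _) fun j => norm_le_weighted hs j

theorem norm_mk_le_of_mem_ball (hs : 0 ≤ s) (hz : z ∈ ball N s M) :
    ‖L1.mk z (summable_norm_of_mem_ball hs hz)‖ ≤ M := by
  rw [L1.norm_eq]
  exact ((summable_norm_of_mem_ball hs hz).tsum_le_tsum (fun j => norm_le_weighted hs j) hz.1).trans
    hz.2

theorem summable_weighted_actions (hz : z ∈ ball N s M) :
    Summable (fun a : N => modeSize a ^ (2 * s) * ‖z (a, 1) * z (a, -1)‖) ∧
      ∑' a : N, modeSize a ^ (2 * s) * ‖z (a, 1) * z (a, -1)‖ ≤ M * M := by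
  have hw : ∀ a : N, modeSize a ^ s * modeSize a ^ s = modeSize a ^ (2 * s) := fun a => by
    rw [two_mul, Real.rpow_add (zero_lt_one.trans_le (one_le_modeSize a))]
  have h := summable_mul_pair (w := fun a : N => modeSize a ^ s)
    (fun a => Real.rpow_nonneg (zero_le_one.trans (one_le_modeSize a)) s) hz.1 hz.2
  simp only [hw] at h
  exact h

variable {m B : ℝ} {ω : N → ℝ} {h : ℝ}

/-- On the weighted ball the field of `A₀` is `O(h)`, better than the `O(√h)` valid on `ℓ¹`; this
makes the first bracket `O(h²)`. -/
theorem norm_diag_filter_le (hms : m ≤ s) (hB : 0 < B) (hω : ∀ a, |ω a| ≤ B * modeSize a ^ m)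
    (hh : 0 < h) (hz : z ∈ ball N s M) (c : ℝ)
    (hμ : ∀ j : Idx N, ‖-Complex.I * j.sign * ((filterFun h (h * ω j.1) : ℝ) : ℂ)‖ ≤ c)
    (zL : L1 (Idx N)) (hzL : ∀ j, L1.coord zL j = z j) :
    ‖L1.diag (fun j : Idx N => -Complex.I * j.sign * ((filterFun h (h * ω j.1) : ℝ) : ℂ)) c hμ zL‖
      ≤ h * B * M := by
  have hle : ∀ j : Idx N, ‖-Complex.I * j.sign * ((filterFun h (h * ω j.1) : ℝ) : ℂ) * z j‖
      ≤ h * B * (modeSize j.1 ^ s * ‖z j‖) := by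
    intro j
    rw [norm_mul, norm_mul, norm_mul, norm_neg, Complex.norm_I, Idx.norm_sign, one_mul, one_mul,
      Complex.norm_real, ← mul_assoc]
    refine mul_le_mul_of_nonneg_right ((abs_filterFun_le hh _).trans ?_) (norm_nonneg _)
    rw [mul_assoc]
    exact mul_le_mul_of_nonneg_left ((hω j.1).trans
      (mul_le_mul_of_nonneg_left (modeSize_rpow_le hms _) hB.le)) hh.le
  rw [L1.norm_eq]
  simp only [L1.coord_diag, hzL]
  refine (summable_and_tsum_le_of_norm_le _ _ (hz.1.mul_left (h * B)) hle).2.trans ?_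
  rw [tsum_mul_left]
  exact mul_le_mul_of_nonneg_left hz.2 (by positivity)

theorem norm_filtered_sub_le (hms : 3 * m ≤ 2 * s) (hB : 0 < B)
    (hω : ∀ a, |ω a| ≤ B * modeSize a ^ m) (hm : 0 < m) (hh : 0 < h) (hz : z ∈ ball N s M) :
    ‖∑' a : N, ((filterFun h (h * ω a) : ℝ) : ℂ) * (z (a, 1) * z (a, -1))
      - h * ∑' a : N, (ω a : ℂ) * (z (a, 1) * z (a, -1))‖ ≤ h ^ 2 * (B ^ 3 * (M * M)) := by
  obtain ⟨hS, hS'⟩ := summable_weighted_actions hz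
  refine norm_tsum_mul_sub_le (v := fun a : N => modeSize a ^ (2 * s)) hB.le hS hS'
    (fun a => ?_) (fun a => abs_filterFun_le hh _) (fun a => ?_)
  · exact (hω a).trans (mul_le_mul_of_nonneg_left (modeSize_rpow_le (by linarith) a) hB.le)
  · refine (abs_filterFun_sub_le hh _).trans (mul_le_mul_of_nonneg_left ?_ (sq_nonneg h))
    calc |ω a| ^ 3 ≤ (B * modeSize a ^ m) ^ 3 := pow_le_pow_left₀ (abs_nonneg _) (hω a) 3
      _ = B ^ 3 * modeSize a ^ (3 * m) := by
          rw [mul_pow, ← Real.rpow_natCast (modeSize a ^ m),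
            ← Real.rpow_mul (zero_le_one.trans (one_le_modeSize a)), mul_comm m]
          norm_num
      _ ≤ _ := mul_le_mul_of_nonneg_left (modeSize_rpow_le hms a) (by positivity)

end Ball

/-- The flow hypothesis, rescaled to unit time. -/
theorem exists_unit_time_flow (F : HamFun (symplecticForm N)) {f : (Idx N → ℂ) → ℂ}
    (hf : ∀ z : L1 (Idx N), f (L1.coord z) = F.val z) {h : ℝ} (hh : 0 < h) {z w : Idx N → ℂ}
    (hzw : IsFlow f h z w) : ∃ φ : ℝ → L1 (Idx N), L1.coord (φ 0) = z ∧ L1.coord (φ 1) = w ∧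
      ∀ t ∈ Set.Icc (0 : ℝ) 1,
        HasDerivWithinAt φ (((h : ℂ) • F).field (φ t)) (Set.Icc 0 1) t := by
  obtain ⟨φ, h0, h1, hφ⟩ := hzw
  refine ⟨fun t => φ (h * t), ?_, ?_, fun t ht => ?_⟩
  · change L1.coord (φ (h * 0)) = z
    rw [mul_zero]
    exact h0
  · change L1.coord (φ (h * 1)) = w
    rw [mul_one]
    exact h1
  · have hmaps : Set.MapsTo (fun t : ℝ => h * t) (Set.Icc 0 1) (Set.Icc 0 h) := fun τ hτ =>
      ⟨mul_nonneg hh.le hτ.1, mul_le_of_le_one_right hh.le hτ.2⟩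
    obtain ⟨v, hv, hd⟩ := hφ (h * t) (hmaps ht)
    have hv' : v = F.field (φ (h * t)) :=
      L1.ext_coord fun j => congrFun (hv.trans (vectorField_eq_field F hf (φ (h * t)))) j
    have hlin : HasDerivWithinAt (fun t : ℝ => h * t) h (Set.Icc 0 1) t := by
      simpa using ((hasDerivAt_id t).const_mul h).hasDerivWithinAt
    have hc := HasDerivWithinAt.scomp t (h := fun t : ℝ => h * t) hd hlin hmaps
    rw [hv'] at hc
    exact hc

/-- Comparison with the barrier `M + M t`: the speed is below `M` wherever the solution touches it.
-/
theorem norm_flow_le {E : Type*} [NormedAddCommGroup E] [NormedSpace ℝ E] {X : E → E} {M : ℝ}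
    (hX : ∀ z, ‖z‖ ≤ 2 * M → ‖X z‖ < M) {φ : ℝ → E}
    (hφ : ∀ t ∈ Set.Icc (0 : ℝ) 1, HasDerivWithinAt φ (X (φ t)) (Set.Icc 0 1) t) (h0 : ‖φ 0‖ ≤ M)
    (hM : 0 < M) : ∀ t ∈ Set.Icc (0 : ℝ) 1, ‖φ t‖ ≤ 2 * M := by
  have h := image_norm_le_of_norm_deriv_right_lt_deriv_boundary (f := φ) (f' := fun t => X (φ t))
    (a := 0) (b := 1) (B := fun t => M + M * t) (B' := fun _ => M)
    (fun t ht => (hφ t ht).continuousWithinAt)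
    (fun t ht => (hφ t ⟨ht.1, ht.2.le⟩).mono_of_mem_nhdsWithin (Icc_mem_nhdsGE_of_mem ht))
    (by simpa using h0)
    (fun t => by simpa using ((hasDerivAt_id t).const_mul M).const_add M)
    (fun t ht hb => hX _ (by rw [hb]; nlinarith [ht.2]))
  intro t ht
  exact (h ht).trans (by nlinarith [ht.2])

/-- One term of the exponential series, with `384 = 2 ^ 4 · 4!`; the fourth power of `1 / √h`
becomes `h ^ 2`. -/
theorem exp_neg_half_le {y : ℝ} (hy : 0 < y) : Real.exp (-(y / 2)) ≤ 384 / y ^ 4 := by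
  have h := Real.pow_div_factorial_le_exp (y / 2) (by positivity) 4
  rw [Real.exp_neg, inv_le_comm₀ (Real.exp_pos _) (by positivity), inv_div]
  refine le_trans (le_of_eq ?_) h
  norm_num [Nat.factorial]
  ring

theorem quarter_pow_le {y : ℝ} {n : ℕ} (h : y ≤ n + 2) : (1 / 4 : ℝ) ^ n ≤ 16 * Real.exp (-y) := by
  have h1 : Real.exp 1 ≤ 4 := by have := Real.exp_one_lt_d9; linarith
  have h2 : Real.exp y ≤ 4 ^ (n + 2) := by
    calc Real.exp y ≤ Real.exp ((n + 2 : ℕ) * 1) := Real.exp_le_exp.2 (by push_cast; linarith)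
      _ = Real.exp 1 ^ (n + 2) := Real.exp_nat_mul 1 (n + 2)
      _ ≤ 4 ^ (n + 2) := pow_le_pow_left₀ (Real.exp_pos 1).le h1 _
  rw [Real.exp_neg, ← div_eq_mul_inv, le_div_iff₀ (Real.exp_pos y), one_div, inv_pow,
    inv_mul_le_iff₀ (by positivity)]
  refine h2.trans_eq ?_
  ring

end Splitting

/-! ### The modified energy and its conservation over exponentially long times. -/

namespace Splitting

variable {d : ℕ} {N : Set (Fin d → ℤ)}

/-- The splitting method nearly conserves a modified energy which is close to `h H`. -/
theorem exists_modified_energy {r₀ : ℕ} {s M m B h b : ℝ} (hM : 0 < M) (hm : 0 < m) (hB : 0 < B)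
    (hms : 3 * m / 2 ≤ s) {ω : N → ℝ} (hω : ∀ a, |ω a| ≤ B * modeSize a ^ m) (P : PolyHam N r₀)
    (hb : 0 ≤ b) (hPb : 2 * r₀ * (2 * M + 1) ^ r₀ * P.norm ≤ b) (hh : 0 < h) (hh1 : h ≤ 1)
    (hhb : h * b < M) {Γ : ℝ} (hΓ : Γ = 2 * (2 * M + 1) + 2 * b) {n : ℕ}
    (hn : 64 * ((n : ℝ) + 1) * (Γ * Real.sqrt h) ≤ 1) :
    ∃ K : (Idx N → ℂ) → ℂ,
      (∀ z ∈ ball N s M, ∀ w ∈ ball N s M, IsFlow P.eval h (filteredFlow h ω z) w →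
        ‖K w - K z‖ ≤ 8 * (Γ * Real.sqrt h) ^ 2 * (1 / 4) ^ n) ∧
      ∀ z ∈ ball N s M, ‖K z - h * hamiltonian ω P z‖
        ≤ (1 / 2 * (B * M * b) + 108 * b * 256 * Γ ^ 2 * (2 * M) + B ^ 3 * (M * M)) * h ^ 2 := by
  have hs : 0 ≤ s := by linarith
  have hsq : 0 < Real.sqrt h := Real.sqrt_pos.2 hh
  have hsq2 : Real.sqrt h ^ 2 = h := Real.sq_sqrt hh.le
  have hsq1 : Real.sqrt h ≤ 1 := Real.sqrt_le_one.2 hh1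
  have hhsq : h ≤ Real.sqrt h := by nlinarith
  have hΓ0 : 0 < Γ := by rw [hΓ]; positivity
  obtain ⟨F, hFval, hFfield⟩ := exists_polyHam_hamFun P
  obtain ⟨A, hμ, hAfield, hAval⟩ := exists_quadratic_hamFun (fun a => filterFun h (h * ω a))
    (2 * Real.sqrt h) fun a => abs_filterFun_le_sqrt _
  have hF : ∀ z, ‖z‖ ≤ 2 * M + 1 → ‖((h : ℂ) • F).field z‖ ≤ h * b := fun z hz => by
    rw [HamFun.smul_field, norm_smul, Complex.norm_real, Real.norm_of_nonneg hh.le]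
    exact mul_le_mul_of_nonneg_left ((hFfield _ (by linarith) z hz).trans hPb) hh.le
  have hA : ∀ z, ‖z‖ ≤ 2 * M + 1 → ‖A.field z‖ ≤ 2 * Real.sqrt h * (2 * M + 1) := fun z hz => by
    rw [hAfield]
    exact (L1.norm_diag_le _ _ hμ z).trans (mul_le_mul_of_nonneg_left hz (by positivity))
  have hβ := HamFun.supNorm_le ((h : ℂ) • F) (by positivity) hF
  have hα := HamFun.supNorm_le A (by positivity) hA
  -- Radius `2M` contains both flows and the extra radius `1` is spent on Cauchy estimates. The
  -- definition of `Γ` adds the bound for `A` to twice that for `hP`, using `h ≤ √h`.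
  obtain ⟨K, hK, hKH⟩ := HamFun.exists_almost_invariant A ((h : ℂ) • F) (R := 2 * M) (δ := 1)
    (ε := Γ * Real.sqrt h) (β := h * b) (by positivity) one_pos (by positivity)
    (by rw [hΓ]; nlinarith [mul_le_mul_of_nonneg_right hhsq hb]) hβ n hn
  let lift : ∀ z ∈ ball N s M, L1 (Idx N) := fun z hz => L1.mk z (summable_norm_of_mem_ball hs hz)
  have hlift : ∀ z hz, ‖lift z hz‖ ≤ M := fun z hz => norm_mk_le_of_mem_ball hs hz
  have hcoord : ∀ z hz j, L1.coord (lift z hz) j = z j := fun z hz j => rfl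
  classical
  refine ⟨fun z => if hz : z ∈ ball N s M then K.val (lift z hz) else 0, ?_, ?_⟩
  · intro z hz w hw hzw
    simp only [hz, hw, dif_pos]
    obtain ⟨φ, hφ0, hφ1, hφ⟩ := exists_unit_time_flow F (f := P.eval)
      (fun z => (hFval z).symm) hh hzw
    obtain ⟨ψ, hψ0, hψ, hψn, hψ1⟩ := L1.exists_diag_flow _ _ hμ
      (fun j => by simp [Idx.sign]) (lift z hz)
    have hjoin : ψ 1 = φ 0 := L1.ext_coord fun j => by
      rw [hψ1, hφ0]
      rfl
    have hφ1' : φ 1 = lift w hw := L1.ext_coord fun j => by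
      rw [hφ1]
      rfl
    have hbound := norm_flow_le (fun z hz => (hF z (by linarith)).trans_lt hhb) hφ
      (by rw [← hjoin, hψn]; exact hlift z hz) hM
    have := hK φ ψ (fun t _ => by rw [hAfield]; exact (hψ t).hasDerivWithinAt) hφ
      (fun t _ => by rw [hψn]; linarith [hlift z hz]) hbound hjoin
    rwa [hφ1', hψ0] at this
  · intro z hz
    simp only [hz, dif_pos]
    have hzn := hlift z hz
    have h1 := hKH (lift z hz) (by linarith)
    -- Only this estimate and `h4` use the growth bound on the frequencies, so `B` and `m` affect
    -- closeness to `hH` but not the one-step error.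
    have h2 : ‖A.field (lift z hz)‖ ≤ h * B * M := by
      rw [hAfield]
      exact norm_diag_filter_le (by linarith) hB hω hh hz _ hμ _ (hcoord z hz)
    have h3 := hF (lift z hz) (by linarith)
    have h4 := norm_filtered_sub_le (by linarith) hB hω hm hh hz
    have h5 : K.val (lift z hz) - h * hamiltonian ω P z
        = (K.val (lift z hz) - (A.val (lift z hz) + ((h : ℂ) • F).val (lift z hz)))
          + (∑' a : N, ((filterFun h (h * ω a) : ℝ) : ℂ) * (z (a, 1) * z (a, -1))
            - h * ∑' a : N, (ω a : ℂ) * (z (a, 1) * z (a, -1))) := by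
      have hPz : F.val (lift z hz) = P.eval z := hFval _
      have hAz : A.val (lift z hz)
        = ∑' a : N, ((filterFun h (h * ω a) : ℝ) : ℂ) * (z (a, 1) * z (a, -1)) := hAval _
      rw [HamFun.smul_val, hPz, hAz, hamiltonian, smul_eq_mul]
      ring
    rw [h5]
    refine (norm_add_le _ _).trans ((add_le_add (h1.trans (add_le_add (mul_le_mul_of_nonneg_left
      (mul_le_mul h2 h3 (norm_nonneg _) (by positivity)) (by norm_num)) le_rfl)) h4).trans_eq ?_)
    rw [div_one, mul_pow, mul_pow, hsq2]
    ring

theorem norm_sub_le_of_step {E X : Type*} [SeminormedAddCommGroup E] {f : X → E} {z : ℕ → X}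
    {e : ℝ} (h : ∀ n, ‖f (z (n + 1)) - f (z n)‖ ≤ e) (n : ℕ) : ‖f (z n) - f (z 0)‖ ≤ n * e := by
  induction n with
  | zero => simp
  | succ n ih =>
    rw [← sub_add_sub_cancel _ (f (z n))]
    refine (norm_add_le_of_le (h n) ih).trans_eq ?_
    push_cast
    ring

/-- The accumulated exponentially small errors over exponentially long times. -/
theorem long_time_error_le {Γ h : ℝ} (hΓ : 0 < Γ) (hh : 0 < h) {k n : ℕ}
    (hk : 1 / (64 * Γ * Real.sqrt h) ≤ k + 2)
    (hn : (n : ℝ) * h ≤ Real.exp (1 / (128 * Γ) / Real.sqrt h)) :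
    n * (8 * (Γ * Real.sqrt h) ^ 2 * (1 / 4) ^ k)
      ≤ 128 * Γ ^ 2 * 384 * (64 * Γ) ^ 4 * h ^ 2 := by
  have hsq : 0 < Real.sqrt h := Real.sqrt_pos.2 hh
  have hsq2 : Real.sqrt h ^ 2 = h := Real.sq_sqrt hh.le
  set y := 1 / (64 * Γ * Real.sqrt h) with hy
  have hy0 : 0 < y := by positivity
  -- Half of the exponent pays for the number of steps; the other half remains to produce `h ^ 2`.
  have hc : 1 / (128 * Γ) / Real.sqrt h = y / 2 := by
    rw [hy]
    field_simp
    norm_num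
  have hy4 : 384 / y ^ 4 = 384 * (64 * Γ) ^ 4 * h ^ 2 := by
    have hq : Real.sqrt h ^ 4 = h ^ 2 := by
      nth_rewrite 2 [← hsq2]
      ring
    rw [hy, ← hq]
    field_simp
  rw [hc] at hn
  calc n * (8 * (Γ * Real.sqrt h) ^ 2 * (1 / 4) ^ k)
      ≤ n * (8 * (Γ * Real.sqrt h) ^ 2 * (16 * Real.exp (-y))) := by
        gcongr
        exact quarter_pow_le hk
    _ = 128 * Γ ^ 2 * (n * h * Real.exp (-y)) := by
        rw [mul_pow, hsq2]
        ring
    _ ≤ 128 * Γ ^ 2 * (Real.exp (y / 2) * Real.exp (-y)) := by gcongr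
    _ = 128 * Γ ^ 2 * Real.exp (-(y / 2)) := by
        rw [← Real.exp_add]
        congr 2
        ring
    _ ≤ 128 * Γ ^ 2 * (384 / y ^ 4) := by
        gcongr
        exact exp_neg_half_le hy0
    _ = _ := by
        rw [hy4]
        ring

end Splitting

theorem mainTheorem9 (d : ℕ) (hd : 1 ≤ d) (N : Set (Fin d → ℤ))
    (hN : N = Set.univ ∨ N = {a | ∀ i, 0 ≤ a i})
    (r₀ : ℕ) (hr₀ : 3 ≤ r₀) (K s M : ℝ) (hM : 0 < M) :
    ∃ h₀ : ℝ, 0 < h₀ ∧ ∃ c : ℝ, 0 < c ∧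
      ∀ m B : ℝ, 0 < m → 0 < B → 3 * m / 2 ≤ s → ∃ C : ℝ,
        ∀ ω : N → ℝ, (∀ a, |ω a| ≤ B * Splitting.modeSize a ^ m) →
        ∀ P : Splitting.PolyHam N r₀, P.norm ≤ K →
        ∀ h : ℝ, 0 < h → h ≤ h₀ →
        ∀ z : ℕ → Splitting.Idx N → ℂ, Splitting.IsRealSeq (z 0) →
          (∀ n, Splitting.IsFlow P.eval h (Splitting.filteredFlow h ω (z n)) (z (n + 1))) →
          (∀ n, z n ∈ Splitting.ball N s M) →
          ∀ n : ℕ, (n : ℝ) * h ≤ Real.exp (c / Real.sqrt h) →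
            ‖Splitting.hamiltonian ω P (z n) - Splitting.hamiltonian ω P (z 0)‖ ≤ C * h := by
  -- The absolute value keeps `b` nonnegative for every real `K`.
  set b : ℝ := 2 * r₀ * (2 * M + 1) ^ r₀ * |K| with hb
  set Γ : ℝ := 2 * (2 * M + 1) + 2 * b with hΓ
  have hb0 : 0 ≤ b := by positivity
  have hΓ2 : 2 ≤ Γ := by linarith
  have hΓ0 : 0 < Γ := by linarith
  -- The first bound on `h` leaves room for a truncation order; the second keeps the flow of `P` in
  -- the ball of radius `2M`.
  refine ⟨min ((1 / (64 * Γ)) ^ 2) (M / (b + 1)), by positivity, 1 / (128 * Γ), by positivity,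
    fun m B hm hB hms => ⟨128 * Γ ^ 2 * 384 * (64 * Γ) ^ 4 + 2 *
      (1 / 2 * (B * M * b) + 108 * b * 256 * Γ ^ 2 * (2 * M) + B ^ 3 * (M * M)), ?_⟩⟩
  set C₁ : ℝ := 128 * Γ ^ 2 * 384 * (64 * Γ) ^ 4
  set C₂ : ℝ := 1 / 2 * (B * M * b) + 108 * b * 256 * Γ ^ 2 * (2 * M) + B ^ 3 * (M * M) with hC₂
  intro ω hω P hP h hh hh0 z _ hflow hball n hn
  have hsq : 0 < Real.sqrt h := Real.sqrt_pos.2 hh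
  have hsqle : Real.sqrt h ≤ 1 / (64 * Γ) := by
    rw [← Real.sqrt_sq (show 0 ≤ 1 / (64 * Γ) by positivity)]
    exact Real.sqrt_le_sqrt (hh0.trans (min_le_left _ _))
  have hΓ1 : 1 / (64 * Γ) ≤ 1 := by
    rw [div_le_one (by positivity)]
    linarith
  have hh1 : h ≤ 1 := by
    rw [← Real.sq_sqrt hh.le]
    exact pow_le_one₀ hsq.le (hsqle.trans hΓ1)
  have hhb : h * b < M := by
    have h1 : h * (b + 1) ≤ M := (le_div_iff₀ (by positivity)).1 (hh0.trans (min_le_right _ _))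
    linarith
  have hPb : 2 * r₀ * (2 * M + 1) ^ r₀ * P.norm ≤ b :=
    mul_le_mul_of_nonneg_left (hP.trans (le_abs_self K)) (by positivity)
  have hy1 : 1 ≤ 1 / (64 * Γ * Real.sqrt h) := by
    rw [le_div_iff₀ (by positivity), one_mul]
    rw [le_div_iff₀ (by positivity)] at hsqle
    linarith
  -- The largest admissible order: `k + 1` satisfies the smallness condition, while `k + 2` bounds
  -- the exponent from above.
  obtain ⟨k, hk⟩ : ∃ k, ⌊1 / (64 * Γ * Real.sqrt h)⌋₊ = k + 1 :=
    Nat.exists_eq_add_of_le' (Nat.le_floor (by exact_mod_cast hy1))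
  have hk1 : (k : ℝ) + 1 ≤ 1 / (64 * Γ * Real.sqrt h) := by
    have := Nat.floor_le (zero_le_one.trans hy1)
    rw [hk] at this
    exact_mod_cast this
  have hk2 : 1 / (64 * Γ * Real.sqrt h) ≤ k + 2 := by
    have := (Nat.lt_floor_add_one (1 / (64 * Γ * Real.sqrt h))).le
    rw [hk] at this
    push_cast at this
    linarith
  obtain ⟨E, hE, hEH⟩ := Splitting.exists_modified_energy hM hm hB hms hω P hb0 hPb hh hh1 hhb hΓ
    (n := k) (by rw [le_div_iff₀ (by positivity)] at hk1; linarith)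
  have h1 := (Splitting.norm_sub_le_of_step (f := E) (z := z)
    (fun i => hE _ (hball i) _ (hball (i + 1)) (hflow i)) n).trans
    (Splitting.long_time_error_le hΓ0 hh hk2 hn)
  have h2 := hEH _ (hball n)
  have h3 := hEH _ (hball 0)
  have h4 : h * ‖Splitting.hamiltonian ω P (z n) - Splitting.hamiltonian ω P (z 0)‖
      ≤ h * ((C₁ + 2 * C₂) * h) := by
    calc h * ‖Splitting.hamiltonian ω P (z n) - Splitting.hamiltonian ω P (z 0)‖
        = ‖(h : ℂ) * (Splitting.hamiltonian ω P (z n) - Splitting.hamiltonian ω P (z 0))‖ := by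
          rw [norm_mul, Complex.norm_real, Real.norm_of_nonneg hh.le]
      _ = ‖(E (z n) - E (z 0)) - (E (z n) - h * Splitting.hamiltonian ω P (z n))
            + (E (z 0) - h * Splitting.hamiltonian ω P (z 0))‖ := by
          congr 1
          ring
      _ ≤ C₁ * h ^ 2 + C₂ * h ^ 2 + C₂ * h ^ 2 :=
          norm_add_le_of_le (norm_sub_le_of_le h1 h2) h3
      _ = _ := by ring
  exact le_of_mul_le_mul_left h4 hh
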